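/- Throughout, algorithms are deterministic multi-tape Turing machines. A QUBO instance is a Hamiltonian $$H(x_1,\dots,x_n)=\sum_{i=1}^n w_i x_i+\sum_{1\le i<j\le n} w_{ij}x_ix_j,\qquad w_i,w_{ij}\in\mathbb Z,$$ given as an upper triangular $n\times n$ matrix with entries written in binary; $|H|$ denotes the length of this encoding. To solve QUBO means to compute, for every given $H$, a ground state, i.e. a vector $x\in\{0,1\}^n$ that minimizes $H(x)$. The terms of $H$ are the $w_ix_i$ and $w_{ij}x_ix_j$ with nonzero weight. The primal treewidth $\mathrm{tw}(H)$ is the treewidth of the graph on the variables in which two variables are adjacent if they occur together in a term; the incidence treewidth $\mathrm{itw}(H)$ is the treewidth of the bipartite graph on the variables and terms in which a variable is adjacent to the terms containing it. (The graph without vertices is given treewidth $0$.) ETH is the hypothesis that there is a $\delta>0$ such that 3-SAT on formulas $\varphi$ with $n$ variables cannot be decided in time $2^{\delta n}\cdot\mathrm{poly}(|\varphi|)$. SETH is the hypothesis that for every $\delta<1$ there is a $k$ such that $k$-SAT on formulas $\varphi$ with $n$ variables cannot be decided in time $2^{\delta n}\cdot\mathrm{poly}(|\varphi|)$. **Corollary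 (QUBO Lower Bound).** 1. Assume SETH. Then for every $\varepsilon>0$, QUBO cannot be solved in time $2^{(1-\varepsilon)\,\mathrm{tw}(H)}\cdot\mathrm{poly}(|H|)$. Moreover, for every function $f\colon\mathbb N\to\mathbb R$ with $f(k)=o(2^{k/3})$, QUBO cannot be solved in time $f(\mathrm{itw}(H))\cdot\mathrm{poly}(|H|)$; in particular, for no $\varepsilon>0$ in time $2^{(1-\varepsilon)\,\mathrm{itw}(H)/3}\cdot\mathrm{poly}(|H|)$. 2. Assume ETH. Then for every function $g\colon\mathbb N\to\mathbb R$ with $g(k)=o(k)$, QUBO can be solved neither in time $2^{g(\mathrm{tw}(H))}\cdot\mathrm{poly}(|H|)$ nor in time $2^{g(\mathrm{itw}(H))}\cdot\mathrm{poly}(|H|)$. -/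

import Mathlib

open Filter Asymptotics
open Computability (Γ' encodeNat unaryEncodeNat)

/-! ### Treewidth -/

/-- A tree decomposition of a graph: a finite tree `tree`, each node `t` of which carries a finite
bag of vertices, such that the nodes whose bags contain a given vertex induce a nonempty connected
subgraph (hence a subtree), and every edge is contained in some bag.  (Choosing a root of the tree
is immaterial for the width.) -/
structure TreeDecomposition {V : Type} (G : SimpleGraph V) where
  Node : Type
  [fintypeNode : Fintype Node]
  tree : SimpleGraph Node
  isTree : tree.IsTree
  bag : Node → Finset V
  connected : ∀ v : V, (tree.induce {t : Node | v ∈ bag t}).Connected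
  cover : ∀ u v : V, G.Adj u v → ∃ t : Node, u ∈ bag t ∧ v ∈ bag t

attribute [instance] TreeDecomposition.fintypeNode

/-- The width of a tree decomposition: the maximal size of a bag, minus one. -/
def TreeDecomposition.width {V : Type} {G : SimpleGraph V} (D : TreeDecomposition G) : ℕ :=
  (Finset.univ.sup fun t : D.Node => (D.bag t).card) - 1

/-- The treewidth of a graph: the minimal width of a tree decomposition.  (With truncated
subtraction the graph without vertices gets treewidth `0`.) -/
noncomputable def treewidth {V : Type} (G : SimpleGraph V) : ℕ :=
  sInf {w : ℕ | ∃ D : TreeDecomposition G, D.width = w}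

/-- A graph on finitely many vertices has a tree decomposition: a single bag with all vertices. -/
theorem nonempty_treeDecomposition {V : Type} [Fintype V] (G : SimpleGraph V) :
    Nonempty (TreeDecomposition G) := by
  have hsub : ∀ (s : Set Unit), s.Nonempty → ((⊥ : SimpleGraph Unit).induce s).Connected := by
    intro s hs
    have : Nonempty s := hs.to_subtype
    have : Subsingleton s := inferInstance
    exact { preconnected := fun a b => by rw [Subsingleton.elim a b]
            nonempty := inferInstance }
  exact ⟨{ Node := Unit
           tree := ⊥
           isTree := SimpleGraph.IsTree.of_subsingleton
           bag := fun _ => Finset.univ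
           connected := fun v => hsub _ ⟨(), by simp⟩
           cover := fun u v _ => ⟨(), by simp⟩ }⟩

/-! ### Quadratic unconstrained binary optimization -/

/-- A Hamiltonian `H(x₁,…,xₙ) = ∑ i, wᵢ xᵢ + ∑ i < j, wᵢⱼ xᵢ xⱼ` with integer weights, given by an
upper triangular matrix; the diagonal entry `weight i i` is the weight `wᵢ` of the linear term. -/
structure QUBO where
  n : ℕ
  weight : Matrix (Fin n) (Fin n) ℤ
  upper : ∀ i j : Fin n, j < i → weight i j = 0

namespace QUBO

/-- The value `H(x)` at a vector `x ∈ {0,1}ⁿ`. -/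
def energy (H : QUBO) (x : Fin H.n → Bool) : ℤ :=
  ∑ i, H.weight i i * (x i).toInt +
    ∑ i, ∑ j ∈ Finset.Ioi i, H.weight i j * (x i).toInt * (x j).toInt

/-- `x` is a ground state of `H`: it minimizes `H` over `{0,1}ⁿ`. -/
def IsGroundState (H : QUBO) (x : Fin H.n → Bool) : Prop :=
  ∀ y : Fin H.n → Bool, H.energy x ≤ H.energy y

/-- The terms of `H`: the index pairs `i ≤ j` with a nonzero weight; `(i, i)` is the linear term
in `xᵢ`, and `(i, j)` with `i < j` is the quadratic term in `xᵢ xⱼ`. -/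
def Term (H : QUBO) : Type :=
  {p : Fin H.n × Fin H.n // p.1 ≤ p.2 ∧ H.weight p.1 p.2 ≠ 0}

/-- The primal graph of `H`: two variables are adjacent if they appear together in a term. -/
def primalGraph (H : QUBO) : SimpleGraph (Fin H.n) :=
  SimpleGraph.fromRel fun u v =>
    ∃ t : H.Term, (u = t.1.1 ∨ u = t.1.2) ∧ (v = t.1.1 ∨ v = t.1.2)

/-- The incidence graph of `H`: its vertices are the variables and the terms, and a variable is
adjacent to the terms that contain it. -/
def incidenceGraph (H : QUBO) : SimpleGraph (Fin H.n ⊕ H.Term) :=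
  SimpleGraph.fromRel fun a b =>
    ∃ (v : Fin H.n) (t : H.Term), a = Sum.inl v ∧ b = Sum.inr t ∧ (v = t.1.1 ∨ v = t.1.2)

/-- The primal treewidth of `H`. -/
noncomputable def tw (H : QUBO) : ℕ := treewidth H.primalGraph

/-- The incidence treewidth of `H`. -/
noncomputable def itw (H : QUBO) : ℕ := treewidth H.incidenceGraph

end QUBO

/-! ### Formulas in conjunctive normal form -/

/-- A propositional formula in conjunctive normal form over `n` variables.  A literal is a variable
with a sign (`true` for the positive literal), a clause is a list of literals (disjunction), and
the formula is a list of clauses (conjunction). -/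
structure CNFFormula where
  n : ℕ
  clauses : List (List (Fin n × Bool))

namespace CNFFormula

/-- Every clause has at most `k` literals. -/
def IsKCNF (φ : CNFFormula) (k : ℕ) : Prop :=
  ∀ c ∈ φ.clauses, c.length ≤ k

/-- Some assignment makes a literal of every clause true. -/
def Satisfiable (φ : CNFFormula) : Prop :=
  ∃ a : Fin φ.n → Bool, ∀ c ∈ φ.clauses, ∃ l ∈ c, a l.1 = l.2

end CNFFormula

/-! ### Instances as words

All words are over Mathlib's Turing machine alphabet `Γ'`, with the letters `blank`, `bit false`,
`bit true`, `bra`, `ket` and `comma`. -/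

/-- An integer in binary: a sign bit followed by the binary digits of the absolute value, closed by
a comma. -/
def encodeInt (z : ℤ) : List Γ' :=
  Γ'.bit (decide (z < 0)) :: (encodeNat z.natAbs).map Γ'.bit ++ [Γ'.comma]

/-- A Hamiltonian is written as its matrix, row by row, each row in brackets and each entry in
binary. -/
def QUBO.encode (H : QUBO) : List Γ' :=
  (List.ofFn fun i : Fin H.n =>
    Γ'.bra :: (List.ofFn fun j : Fin H.n => encodeInt (H.weight i j)).flatten ++ [Γ'.ket]).flatten

/-- A literal: its sign followed by the index of its variable, closed by a comma.  Variables are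
numbered `0, …, n - 1` and written in unary; as the number of variables is itself a parameter of
the running times below, writing them in binary would change the length by a factor that is at most
polynomial in it. -/
def encodeLiteral {n : ℕ} (l : Fin n × Bool) : List Γ' :=
  Γ'.bit l.2 :: (unaryEncodeNat (l.1 : ℕ)).map Γ'.bit ++ [Γ'.comma]

/-- A formula: the number of variables in unary and a comma, and then the clauses, each in
brackets. -/
def CNFFormula.encode (φ : CNFFormula) : List Γ' :=
  (unaryEncodeNat φ.n).map Γ'.bit ++ Γ'.comma ::
    (φ.clauses.map fun c => Γ'.bra :: (c.map encodeLiteral).flatten ++ [Γ'.ket]).flatten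

/-! ### Running times

Algorithms are deterministic multi-stack (equivalently, multi-tape) Turing machines in the sense of
Mathlib's `Turing.FinTM2`. -/

/-- Started on the word `x`, the machine `M` halts with output `y` after at most `t` steps. -/
def OutputsInTime {Γ₀ Γ₁ : Type} (M : Turing.TM2ComputableAux Γ₀ Γ₁) (x : List Γ₀) (y : List Γ₁)
    (t : ℕ) : Prop :=
  Nonempty (Turing.TM2OutputsInTime M.tm (x.map M.inputAlphabet.invFun)
    (some (y.map M.outputAlphabet.invFun)) t)

/-- QUBO can be solved in time `T(H) · poly(|H|)`: some machine computes, from every Hamiltonian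
`H`, a ground state of `H`, in at most `T(H) · p(|H|)` steps for a fixed polynomial `p`, where
`|H|` is the length of the binary encoding of `H`. -/
def QUBOSolvableInTime (T : QUBO → ℝ) : Prop :=
  ∃ (M : Turing.TM2ComputableAux Γ' Bool) (p : Polynomial ℕ), ∀ H : QUBO,
    ∃ (x : Fin H.n → Bool) (t : ℕ), H.IsGroundState x ∧
      OutputsInTime M H.encode (List.ofFn x) t ∧ (t : ℝ) ≤ T H * (p.eval H.encode.length : ℕ)

/-- `k`-SAT can be decided in time `2 ^ (δ n) · poly(|φ|)`, where `n` is the number of variables of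
the formula `φ`. -/
def KSATSolvableInTime (k : ℕ) (δ : ℝ) : Prop :=
  ∃ (M : Turing.TM2ComputableAux Γ' Bool) (p : Polynomial ℕ), ∀ φ : CNFFormula, φ.IsKCNF k →
    ∃ (b : Bool) (t : ℕ), (b = true ↔ φ.Satisfiable) ∧
      OutputsInTime M φ.encode [b] t ∧
        (t : ℝ) ≤ (2 : ℝ) ^ (δ * (φ.n : ℝ)) * (p.eval φ.encode.length : ℕ)

/-- The exponential time hypothesis: for some `δ > 0`, 3-SAT with `n` variables cannot be decided
in time `2 ^ (δ n) · poly(|φ|)`. -/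
def ETH : Prop :=
  ∃ δ : ℝ, 0 < δ ∧ ¬ KSATSolvableInTime 3 δ

/-- The strong exponential time hypothesis: for every `δ < 1` there is a `k` such that `k`-SAT with
`n` variables cannot be decided in time `2 ^ (δ n) · poly(|φ|)`. -/
def SETH : Prop :=
  ∀ δ : ℝ, δ < 1 → ∃ k : ℕ, ¬ KSATSolvableInTime k δ

/-! The proof reduces `k`-SAT with `n` variables to QUBO so that both treewidths exceed `n` by at
most a constant depending on `k`.

Each clause has one selector per literal and one extra selector for a global guard `g`. Selecting a
literal contributes `-2` if it is true and `0` otherwise, which is a quadratic expression in the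
selector and the variable of the literal. Selecting the guard contributes `-2 g`, and any two
selectors of one clause that are both set are penalized by `4`. Hence a clause contributes at least
`-2`, and this is attainable exactly if it has a true literal or `g = 1`. The guard itself costs
`1`. With `m` clauses the minimum is therefore `-2 m`, with `g = 0`, for a satisfiable formula, and
`1 - 2 m`, with `g = 1`, otherwise: `g = 0` and a false clause force at least `2 - 2 m`. So the
guard bit of any ground state decides satisfiability (`CNFFormula.guard_of_isGroundState`).

Removing the guard and the `n` formula variables leaves pieces that lie inside single clauses and
have size bounded in `k`. A star of bags (`treewidth_le_of_parts`) then bounds both treewidths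
(`CNFFormula.tw_toQUBO_le`, `CNFFormula.itw_toQUBO_le`). Consequently a QUBO algorithm with exponent
`δ` times either width gives, for every `k`, a `k`-SAT algorithm with exponent `δ n`
(`ksatSolvableInTime_of_le`).

Running times refer to concrete Turing machines, so the reduction is itself carried out by one. With
one QUBO variable per input symbol, besides the guard, the matrix can be written by repeated
finite-state passes over the input. Variables are matched with literals by removing one unary digit
from each literal in every variable row. `QUBOWriter.encode_toQUBO` shows that the text written is
the encoded Hamiltonian, and `RowSolver.outputsInTime` that running a solver on it has polynomial
overhead. -/

/-! ### Counting steps -/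

/-- `f` leads from `a` to `b` in exactly `n` steps. -/
def StepsTo {α : Type} (f : α → Option α) (n : ℕ) (a b : α) : Prop :=
  (flip Bind.bind f)^[n] (some a) = some b

namespace StepsTo

variable {α : Type} {f : α → Option α}

theorem refl (a : α) : StepsTo f 0 a a := rfl

theorem trans {m n : ℕ} {a b c : α} (h₁ : StepsTo f m a b) (h₂ : StepsTo f n b c) :
    StepsTo f (m + n) a c := by
  unfold StepsTo at *
  rw [Nat.add_comm, Function.iterate_add_apply, h₁, h₂]

theorem head {n : ℕ} {a b c : α} (h₁ : f a = some b) (h₂ : StepsTo f n b c) :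
    StepsTo f (n + 1) a c := by
  unfold StepsTo at *
  rw [Function.iterate_succ_apply]
  exact (congrArg _ h₁).trans h₂

theorem single {a b : α} (h : f a = some b) : StepsTo f 1 a b := head h (refl b)

theorem evalsToInTime {n t : ℕ} {a b : α} (h : StepsTo f n a b) (hn : n ≤ t) :
    Nonempty (StateTransition.EvalsToInTime f a (some b) t) :=
  ⟨⟨⟨n, h⟩, hn⟩⟩

end StepsTo

/-! ### Machines that write a matrix row by row -/

/-- A finite-state device that keeps a word over `A` and rewrites it once per row of a matrix,
from left to right, while writing the entries of the row.  The initial word is `head` followed by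
the letterwise translation of the input. -/
structure RowTransducer (A S : Type) where
  head : A
  readStart : S
  read : S → Γ' → S × A
  rowStart : S
  step : S → A → S × A × List Γ'
  length_le : ∀ s a, (step s a).2.2.length ≤ 5

namespace RowTransducer

variable {A S : Type} (T : RowTransducer A S)

/-- The translation of an input word, read from the state `s`. -/
def readWord : S → List Γ' → List A
  | _, [] => []
  | s, g :: w => (T.read s g).2 :: readWord (T.read s g).1 w

/-- The initial word. -/
def word (w : List Γ') : List A := T.head :: T.readWord T.readStart w

/-- The word after a pass that starts in the state `s`. -/
def rewrite : S → List A → List A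
  | _, [] => []
  | s, a :: W => (T.step s a).2.1 :: rewrite (T.step s a).1 W

/-- The text written during a pass that starts in the state `s`. -/
def emit : S → List A → List Γ'
  | _, [] => []
  | s, a :: W => (T.step s a).2.2 ++ emit (T.step s a).1 W

/-- The text of the next `k` rows. -/
def rows : ℕ → List A → List Γ'
  | 0, _ => []
  | k + 1, W => Γ'.bra :: T.emit T.rowStart W ++ Γ'.ket :: rows k (T.rewrite T.rowStart W)

theorem length_readWord (s : S) (w : List Γ') : (T.readWord s w).length = w.length := by
  induction w generalizing s with
  | nil => rfl
  | cons g w ih => simp [readWord, ih]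

theorem length_rewrite (s : S) (W : List A) : (T.rewrite s W).length = W.length := by
  induction W generalizing s with
  | nil => rfl
  | cons g w ih => simp [rewrite, ih]

end RowTransducer

/-! ### Composition of a row transducer with a solver -/

namespace RowSolver

/-- The stacks used besides those of the solver. -/
inductive LocalStack
  | input | word | done | count | out | answer
  deriving DecidableEq

instance : Fintype LocalStack :=
  ⟨{.input, .word, .done, .count, .out, .answer}, fun x => by cases x <;> decide⟩

/-- The program points outside the solver. -/
inductive Phase
  | start | read | rewind | row | scan | flush | clear | decode | wipe
  deriving DecidableEq

instance : Fintype Phase :=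
  ⟨{.start, .read, .rewind, .row, .scan, .flush, .clear, .decode, .wipe},
    fun x => by cases x <;> decide⟩

variable {A S : Type} (T : RowTransducer A S) (M : Turing.TM2ComputableAux Γ' Bool)

/-- the alphabets of the stacks. -/
abbrev Alphabet (A : Type) (M : Turing.TM2ComputableAux Γ' Bool) :
    M.tm.K ⊕ LocalStack → Type
  | .inl k => M.tm.Γ k
  | .inr .input => Γ'
  | .inr .word => A
  | .inr .done => A
  | .inr .count => Unit
  | .inr .out => Γ'
  | .inr .answer => Bool

/-- The finite memory outside the solver: the state of the transducer and the letters popped last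
from the various stacks. -/
structure Memory (A S : Type) where
  state : S
  sym : Option A
  letter : Option Γ'
  bit : Option Bool

instance [Fintype A] [Fintype S] : Fintype (Memory A S) :=
  Fintype.ofEquiv (S × Option A × Option Γ' × Option Bool)
    { toFun := fun x => ⟨x.1, x.2.1, x.2.2.1, x.2.2.2⟩
      invFun := fun x => (x.state, x.sym, x.letter, x.bit)
      left_inv := fun _ => rfl
      right_inv := fun _ => rfl }

/-- The statements of the composed machine. -/
abbrev Statement (A S : Type) (M : Turing.TM2ComputableAux Γ' Bool) : Type :=
  Turing.TM2.Stmt (Alphabet A M) (M.tm.Λ ⊕ Phase) (M.tm.σ × Memory A S)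

open Turing.TM2.Stmt

/-- Push the letters of a word of length at most `n` to the stack `out`, the last one first. -/
def pushAll (f : M.tm.σ × Memory A S → List Γ') :
    ℕ → Statement A S M → Statement A S M
  | 0, q => q
  | n + 1, q =>
    branch (fun v => ((f v)[n]?).isSome)
      (push (.inr .out) (fun v => ((f v)[n]?).getD Γ'.blank) (pushAll f n q))
      (pushAll f n q)

/-- A statement of the solver, as a statement of the composed machine. -/
def lift : Turing.TM2.Stmt M.tm.Γ M.tm.Λ M.tm.σ → Statement A S M
  | push k f q => push (.inl k) (fun v => f v.1) (lift q)
  | peek k f q => peek (.inl k) (fun v a => (f v.1 a, v.2)) (lift q)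
  | pop k f q => pop (.inl k) (fun v a => (f v.1 a, v.2)) (lift q)
  | load f q => load (fun v => (f v.1, v.2)) (lift q)
  | branch f q₁ q₂ => branch (fun v => f v.1) (lift q₁) (lift q₂)
  | goto f => goto fun v => .inl (f v.1)
  | halt => goto fun _ => .inr .decode

/-- The initial content of the finite memory. -/
def Memory.init : Memory A S := ⟨T.rowStart, none, none, none⟩

/-- The result of a step of the transducer on the letter popped last. -/
def Memory.next (m : Memory A S) : S × A × List Γ' := T.step m.state (m.sym.getD T.head)

/-- The program outside the solver. -/
def program : Phase → Statement A S M
  | .start =>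
    push (.inr .done) (fun _ => T.head) <| push (.inr .count) (fun _ => ()) <|
      load (fun v => (v.1, { v.2 with state := T.readStart })) <| goto fun _ => .inr .read
  | .read =>
    pop (.inr .input) (fun v g => (v.1, { v.2 with letter := g })) <|
      branch (fun v => v.2.letter.isSome)
        (push (.inr .done) (fun v => (T.read v.2.state (v.2.letter.getD Γ'.blank)).2) <|
          push (.inr .count) (fun _ => ()) <|
          load (fun v =>
            (v.1, { v.2 with state := (T.read v.2.state (v.2.letter.getD Γ'.blank)).1 })) <|
          goto fun _ => .inr .read)
        (goto fun _ => .inr .rewind)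
  | .rewind =>
    pop (.inr .done) (fun v a => (v.1, { v.2 with sym := a })) <|
      branch (fun v => v.2.sym.isSome)
        (push (.inr .word) (fun v => v.2.sym.getD T.head) <| goto fun _ => .inr .rewind)
        (goto fun _ => .inr .row)
  | .row =>
    pop (.inr .count) (fun v u => (v.1, { v.2 with bit := u.map fun _ => true })) <|
      branch (fun v => v.2.bit.isSome)
        (push (.inr .out) (fun _ => Γ'.bra) <|
          load (fun v => (v.1, { v.2 with state := T.rowStart })) <| goto fun _ => .inr .scan)
        (goto fun _ => .inr .flush)
  | .scan =>
    pop (.inr .word) (fun v a => (v.1, { v.2 with sym := a })) <|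
      branch (fun v => v.2.sym.isSome)
        (push (.inr .done) (fun v => (v.2.next T).2.1) <|
          pushAll M (fun v => (v.2.next T).2.2.reverse) 5 <|
          load (fun v => (v.1, { v.2 with state := (v.2.next T).1 })) <| goto fun _ => .inr .scan)
        (push (.inr .out) (fun _ => Γ'.ket) <| goto fun _ => .inr .rewind)
  | .flush =>
    pop (.inr .out) (fun v g => (v.1, { v.2 with letter := g })) <|
      branch (fun v => v.2.letter.isSome)
        (push (.inl M.tm.k₀) (fun v => M.inputAlphabet.symm (v.2.letter.getD Γ'.blank)) <|
          goto fun _ => .inr .flush)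
        (goto fun _ => .inr .clear)
  | .clear =>
    pop (.inr .word) (fun v a => (v.1, { v.2 with sym := a })) <|
      branch (fun v => v.2.sym.isSome)
        (goto fun _ => .inr .clear)
        (goto fun _ => .inl M.tm.main)
  | .decode =>
    pop (.inl M.tm.k₁) (fun v b => (v.1, { v.2 with bit := b.map M.outputAlphabet })) <|
      goto fun _ => .inr .wipe
  | .wipe =>
    pop (.inl M.tm.k₁) (fun v b => (v.1, { v.2 with letter := b.map fun _ => Γ'.blank })) <|
      branch (fun v => v.2.letter.isSome)
        (goto fun _ => .inr .wipe)
        (push (.inr .answer) (fun v => !(v.2.bit.getD false)) <|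
          load (fun _ => (M.tm.initialState, Memory.init T)) halt)

/-- The composed machine: it writes the matrix, runs the solver on it, and outputs the negation of
the first bit of the result. -/
def machine [Fintype A] [Fintype S] : Turing.TM2ComputableAux Γ' Bool where
  tm :=
    letI := M.tm.kDecidableEq
    letI := M.tm.kFin
    letI := M.tm.ΛFin
    letI := M.tm.σFin
    { K := M.tm.K ⊕ LocalStack
      k₀ := .inr .input
      k₁ := .inr .answer
      Γ := Alphabet A M
      Λ := M.tm.Λ ⊕ Phase
      main := .inr .start
      σ := M.tm.σ × Memory A S
      initialState := (M.tm.initialState, Memory.init T)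
      Γk₀Fin := inferInstanceAs (Fintype Γ')
      m := Sum.elim (fun l => lift M (M.tm.m l)) (program T M) }
  inputAlphabet := Equiv.refl Γ'
  outputAlphabet := Equiv.refl Bool

/-- The contents of all stacks. -/
def contents (SM : ∀ k, List (M.tm.Γ k)) (i : List Γ') (w d : List A) (c : List Unit) (o : List Γ')
    (a : List Bool) : ∀ k, List (Alphabet A M k)
  | .inl k => SM k
  | .inr .input => i
  | .inr .word => w
  | .inr .done => d
  | .inr .count => c
  | .inr .out => o
  | .inr .answer => a

section

variable {M} (SM : ∀ k, List (M.tm.Γ k)) (i : List Γ') (w d : List A) (c : List Unit) (o : List Γ')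
  (a : List Bool)

open Function (update)

theorem update_inl (k : M.tm.K) (x : List (M.tm.Γ k)) :
    update (contents M SM i w d c o a) (.inl k) x = contents M (update SM k x) i w d c o a := by
  funext j
  rcases j with j | j
  · by_cases h : j = k
    · subst h; simp [contents]
    · simp [contents, h]
  · cases j <;> simp [contents]

theorem update_input (x : List Γ') :
    update (contents M SM i w d c o a) (.inr .input) x = contents M SM x w d c o a := by
  funext j; rcases j with j | j <;> [skip; cases j] <;> simp [contents]

theorem update_word (x : List A) :
    update (contents M SM i w d c o a) (.inr .word) x = contents M SM i x d c o a := by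
  funext j; rcases j with j | j <;> [skip; cases j] <;> simp [contents]

theorem update_done (x : List A) :
    update (contents M SM i w d c o a) (.inr .done) x = contents M SM i w x c o a := by
  funext j; rcases j with j | j <;> [skip; cases j] <;> simp [contents]

theorem update_count (x : List Unit) :
    update (contents M SM i w d c o a) (.inr .count) x = contents M SM i w d x o a := by
  funext j; rcases j with j | j <;> [skip; cases j] <;> simp [contents]

theorem update_out (x : List Γ') :
    update (contents M SM i w d c o a) (.inr .out) x = contents M SM i w d c x a := by
  funext j; rcases j with j | j <;> [skip; cases j] <;> simp [contents]

theorem update_answer (x : List Bool) :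
    update (contents M SM i w d c o a) (.inr .answer) x = contents M SM i w d c o x := by
  funext j; rcases j with j | j <;> [skip; cases j] <;> simp [contents]

theorem stepAux_pushAll (f : M.tm.σ × Memory A S → List Γ') (n : ℕ) (q : Statement A S M)
    (v : M.tm.σ × Memory A S) (o : List Γ') :
    Turing.TM2.stepAux (pushAll M f n q) v (contents M SM i w d c o a) =
      Turing.TM2.stepAux q v (contents M SM i w d c ((f v).take n ++ o) a) := by
  induction n generalizing o with
  | zero => simp [pushAll]
  | succ n ih =>
    rcases h : (f v)[n]? with _ | g
    · have h' : (f v).length ≤ n := by simpa using h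
      simp only [pushAll, Turing.TM2.stepAux, h, Option.isSome_none, cond_false, ih]
      rw [List.take_of_length_le h', List.take_of_length_le (by omega)]
    · simp only [pushAll, Turing.TM2.stepAux, h, Option.isSome_some, cond_true, update_out]
      rw [ih]
      simp [List.take_add_one, h, contents]

end

end RowSolver

namespace RowSolver

variable {A S : Type} (T : RowTransducer A S) (M : Turing.TM2ComputableAux Γ' Bool)

/-- The configurations of the composed machine. -/
abbrev Config (A S : Type) (M : Turing.TM2ComputableAux Γ' Bool) : Type :=
  Turing.TM2.Cfg (Alphabet A M) (M.tm.Λ ⊕ Phase) (M.tm.σ × Memory A S)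

/-- The step function of the composed machine. -/
def step : Config A S M → Option (Config A S M) :=
  Turing.TM2.step (Sum.elim (fun l => lift M (M.tm.m l)) (program T M))

/-- A configuration of the solver, as a configuration of the composed machine. -/
def embed (m : Memory A S) (c : M.tm.Cfg) : Config A S M :=
  ⟨some (c.l.elim (.inr .decode) .inl), (c.var, m), contents M c.stk [] [] [] [] [] []⟩

/-- `lift` touches only the solver's stacks and its component of the memory. Its `halt` becomes the
jump to `decode`, which is also how `embed` renders a missing label. -/
theorem stepAux_lift (m : Memory A S) (q : Turing.TM2.Stmt M.tm.Γ M.tm.Λ M.tm.σ) (v : M.tm.σ)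
    (SM : ∀ k, List (M.tm.Γ k)) :
    Turing.TM2.stepAux (lift M q) (v, m) (contents M SM [] [] [] [] [] []) =
      embed M m (Turing.TM2.stepAux q v SM) := by
  induction q generalizing v SM with
  | push k f q ih => simp only [lift, Turing.TM2.stepAux, update_inl, ih]; rfl
  | peek k f q ih => simp only [lift, Turing.TM2.stepAux, ih]; rfl
  | pop k f q ih => simp only [lift, Turing.TM2.stepAux, update_inl, ih]; rfl
  | load f q ih => simp only [lift, Turing.TM2.stepAux, ih]
  | branch f q₁ q₂ ih₁ ih₂ =>
    simp only [lift, Turing.TM2.stepAux, ih₁, ih₂]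
    cases f v <;> rfl
  | goto f => rfl
  | halt => rfl

theorem stepsTo_embed (m : Memory A S) (n : ℕ) (c c' : M.tm.Cfg)
    (h : StepsTo M.tm.step n c c') : StepsTo (step T M) n (embed M m c) (embed M m c') := by
  induction n generalizing c with
  | zero =>
    have h' : some c = some c' := h
    rw [Option.some.inj h']
    exact .refl _
  | succ n ih =>
    rcases c with ⟨_ | l, v, SM⟩
    -- A halted solver has no successor, so no positive number of steps starts from it.
    · exfalso
      have hn : (flip Bind.bind M.tm.step)^[n + 1]
          (some (⟨none, v, SM⟩ : M.tm.Cfg)) = none := by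
        rw [Function.iterate_succ_apply]
        change (flip Bind.bind M.tm.step)^[n] none = none
        exact Function.iterate_fixed rfl n
      exact absurd (hn.symm.trans h) (by simp)
    · refine StepsTo.head (b := embed M m (Turing.TM2.stepAux (M.tm.m l) v SM)) ?_ (ih _ ?_)
      · exact congrArg some (stepAux_lift M m _ v SM)
      · unfold StepsTo at h ⊢
        rw [Function.iterate_succ_apply] at h
        exact h

/-! ### Step counts of the phases -/

section phases

variable {M} (x : M.tm.σ) (m : Memory A S) (SM : ∀ k, List (M.tm.Γ k))

theorem read_run (i : List Γ') (s : S) (d : List A) (c : List Unit) (hs : m.state = s) :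
    ∃ m', StepsTo (step T M) (i.length + 1)
      ⟨some (.inr .read), (x, m), contents M SM i [] d c [] []⟩
      ⟨some (.inr .rewind), (x, m'), contents M SM [] []
        ((T.readWord s i).reverse ++ d) (List.replicate i.length () ++ c) [] []⟩ := by
  induction i generalizing s d c m with
  | nil =>
    refine ⟨{ m with letter := none }, StepsTo.single ?_⟩
    simp [step, program, update_input, contents, RowTransducer.readWord]
  | cons g i ih =>
    subst hs
    obtain ⟨m', h⟩ := ih { m with letter := some g, state := (T.read m.state g).1 } _
      ((T.read m.state g).2 :: d) (() :: c) rfl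
    refine ⟨m', StepsTo.head ?_ (by simpa [RowTransducer.readWord, List.replicate_succ'] using h)⟩
    simp [step, program, update_input, update_done, update_count, contents]

theorem rewind_run (w d : List A) (c : List Unit) (o : List Γ') :
    ∃ m', StepsTo (step T M) (d.length + 1)
      ⟨some (.inr .rewind), (x, m), contents M SM [] w d c o []⟩
      ⟨some (.inr .row), (x, m'), contents M SM [] (d.reverse ++ w) [] c o []⟩ := by
  induction d generalizing w m with
  | nil =>
    refine ⟨{ m with sym := none }, StepsTo.single ?_⟩
    simp [step, program, update_done, contents]
  | cons g i ih =>
    obtain ⟨m', h⟩ := ih { m with sym := some g } (g :: w)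
    refine ⟨m', StepsTo.head ?_ (by simpa using h)⟩
    simp [step, program, update_word, update_done, contents]

theorem scan_run (w d : List A) (c : List Unit) (o : List Γ') (s : S) (hs : m.state = s) :
    ∃ m', StepsTo (step T M) (w.length + 1)
      ⟨some (.inr .scan), (x, m), contents M SM [] w d c o []⟩
      ⟨some (.inr .rewind), (x, m'), contents M SM [] [] ((T.rewrite s w).reverse ++ d) c
        (Γ'.ket :: (T.emit s w).reverse ++ o) []⟩ := by
  induction w generalizing s d m o with
  | nil =>
    refine ⟨{ m with sym := none }, StepsTo.single ?_⟩
    simp [step, program, update_word, update_out, contents, RowTransducer.rewrite,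
      RowTransducer.emit]
  | cons g w ih =>
    subst hs
    obtain ⟨m', h⟩ := ih { m with sym := some g, state := (T.step m.state g).1 }
      ((T.step m.state g).2.1 :: d) ((T.step m.state g).2.2.reverse ++ o) _ rfl
    refine ⟨m', StepsTo.head ?_ (by simpa [RowTransducer.rewrite, RowTransducer.emit] using h)⟩
    have hl : (T.step m.state g).2.2.reverse.take 5 = (T.step m.state g).2.2.reverse :=
      List.take_of_length_le (by simpa using T.length_le m.state g)
    simp [step, program, update_word, update_done, contents, stepAux_pushAll,
      Memory.next, hl]

/-- A row takes one step in `row`, then a scan and a rewind that each take one step more than the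
length of the word. Only the length of the final word matters, as it is discarded afterwards. -/
theorem rows_run (n : ℕ) (w : List A) (o : List Γ') :
    ∃ m' w', w'.length = w.length ∧ StepsTo (step T M) (n * (2 * w.length + 3) + 1)
      ⟨some (.inr .row), (x, m), contents M SM [] w [] (List.replicate n ()) o []⟩
      ⟨some (.inr .flush), (x, m'), contents M SM [] w' [] []
        ((T.rows n w).reverse ++ o) []⟩ := by
  induction n generalizing w m o with
  | zero =>
    refine ⟨{ m with bit := none }, w, rfl, ?_⟩
    rw [Nat.zero_mul]
    refine StepsTo.single ?_
    simp [step, program, update_count, contents, RowTransducer.rows]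
  | succ n ih =>
    obtain ⟨m₁, h₁⟩ := scan_run T x { m with bit := some true, state := T.rowStart } SM w []
      (List.replicate n ()) (Γ'.bra :: o) _ rfl
    obtain ⟨m₂, h₂⟩ := rewind_run T x m₁ SM [] ((T.rewrite T.rowStart w).reverse ++ [])
      (List.replicate n ()) (Γ'.ket :: (T.emit T.rowStart w).reverse ++ Γ'.bra :: o)
    simp only [List.append_nil, List.length_reverse, T.length_rewrite, List.reverse_reverse] at h₁ h₂
    obtain ⟨m₃, w', hw, h₃⟩ := ih m₂ (T.rewrite T.rowStart w)
      (Γ'.ket :: (T.emit T.rowStart w).reverse ++ Γ'.bra :: o)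
    rw [T.length_rewrite] at h₃ hw
    refine ⟨m₃, w', hw, ?_⟩
    have h := StepsTo.head (f := step T M)
      (a := ⟨some (.inr .row), (x, m), contents M SM [] w [] (List.replicate (n + 1) ()) o []⟩)
      (by simp [step, program, update_count, update_out, contents, List.replicate_succ])
      ((h₁.trans h₂).trans h₃)
    convert h using 1
    · ring
    · simp [RowTransducer.rows]

theorem flush_run (w : List A) (o : List Γ') (l : List (M.tm.Γ M.tm.k₀)) :
    ∃ m', StepsTo (step T M) (o.length + 1)
      ⟨some (.inr .flush), (x, m), contents M
        (Function.update (fun _ => []) M.tm.k₀ l) [] w [] [] o []⟩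
      ⟨some (.inr .clear), (x, m'), contents M
        (Function.update (fun _ => []) M.tm.k₀ (o.reverse.map M.inputAlphabet.symm ++ l))
        [] w [] [] [] []⟩ := by
  induction o generalizing m l with
  | nil =>
    refine ⟨{ m with letter := none }, StepsTo.single ?_⟩
    simp [step, program, update_out, contents]
  | cons g o ih =>
    obtain ⟨m', h⟩ := ih { m with letter := some g } (M.inputAlphabet.symm g :: l)
    refine ⟨m', StepsTo.head ?_ (by simpa using h)⟩
    simp [step, program, update_out, update_inl, contents]

/-- The solver is simulated with empty local stacks, and the halting configuration allows no
leftovers, so the word is removed first. -/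
theorem clear_run (w : List A) :
    ∃ m', StepsTo (step T M) (w.length + 1)
      ⟨some (.inr .clear), (x, m), contents M SM [] w [] [] [] []⟩
      ⟨some (.inl M.tm.main), (x, m'), contents M SM [] [] [] [] [] []⟩ := by
  induction w generalizing m with
  | nil =>
    refine ⟨{ m with sym := none }, StepsTo.single ?_⟩
    simp [step, program, update_word, contents]
  | cons g o ih =>
    obtain ⟨m', h⟩ := ih { m with sym := some g }
    refine ⟨m', StepsTo.head ?_ h⟩
    simp [step, program, update_word, contents]

/-- Only the first output bit is wanted. The rest is removed and the memory reset because a halting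
configuration must carry the initial state and no stack content but the answer. -/
theorem wipe_run (b : Bool) (hb : m.bit = some b) (l : List (M.tm.Γ M.tm.k₁)) :
    StepsTo (step T M) (l.length + 1)
      ⟨some (.inr .wipe), (x, m), contents M
        (Function.update (fun _ => []) M.tm.k₁ l) [] [] [] [] [] []⟩
      ⟨none, (M.tm.initialState, Memory.init T),
        contents M (fun _ => []) [] [] [] [] [] [!b]⟩ := by
  induction l generalizing m with
  | nil =>
    refine StepsTo.single ?_
    simp [step, program, update_inl, update_answer, contents, hb]
  | cons g o ih =>
    refine StepsTo.head ?_ (ih { m with letter := some Γ'.blank } hb)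
    simp [step, program, update_inl, contents]

end phases

theorem initList_eq (tm : Turing.FinTM2) (l : List (tm.Γ tm.k₀)) :
    Turing.initList tm l =
      ⟨some tm.main, tm.initialState, Function.update (fun _ => []) tm.k₀ l⟩ := by
  unfold Turing.initList
  congr 1
  funext k
  by_cases h : k = tm.k₀
  · subst h; simp
  · simp [h]

theorem haltList_eq (tm : Turing.FinTM2) (l : List (tm.Γ tm.k₁)) :
    Turing.haltList tm l =
      ⟨none, tm.initialState, Function.update (fun _ => []) tm.k₁ l⟩ := by
  unfold Turing.haltList
  congr 1
  funext k
  by_cases h : k = tm.k₁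
  · subst h; simp
  · simp [h]

theorem outputsInTime_of_stepsTo {Γ₀ Γ₁ : Type} (M : Turing.TM2ComputableAux Γ₀ Γ₁) {x : List Γ₀}
    {y : List Γ₁} {n t : ℕ}
    (h : StepsTo M.tm.step n
      ⟨some M.tm.main, M.tm.initialState,
        Function.update (fun _ => []) M.tm.k₀ (x.map M.inputAlphabet.invFun)⟩
      ⟨none, M.tm.initialState,
        Function.update (fun _ => []) M.tm.k₁ (y.map M.outputAlphabet.invFun)⟩) (hn : n ≤ t) :
    OutputsInTime M x y t := by
  unfold OutputsInTime Turing.TM2OutputsInTime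
  rw [initList_eq, Option.map_some, haltList_eq]
  exact h.evalsToInTime hn

/-- If the solver turns the matrix into a word that starts with `b` in time `t`, then the composed
machine outputs the negation of `b`, with a polynomial overhead. -/
theorem outputsInTime [Fintype A] [Fintype S] (i : List Γ') (b : Bool) (y : List Bool) (t : ℕ)
    (h : OutputsInTime M (T.rows (i.length + 1) (T.word i)) (b :: y) t) :
    OutputsInTime (machine T M) i [!b]
      (t + (2 * (i.length + 4) ^ 2 + (T.rows (i.length + 1) (T.word i)).length + y.length)) := by
  obtain ⟨⟨⟨n, hn⟩, hnt⟩⟩ := h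
  have hM : StepsTo M.tm.step n _ _ := hn
  rw [initList_eq, haltList_eq] at hM
  set R := T.rows (i.length + 1) (T.word i) with hR
  have hlen : (T.word i).length = i.length + 1 := by
    simp [RowTransducer.word, T.length_readWord]
  obtain ⟨m₁, h₁⟩ := read_run T M.tm.initialState ⟨T.readStart, none, none, none⟩ (fun _ => [])
    i _ [T.head] [()] rfl
  obtain ⟨m₂, h₂⟩ := rewind_run T M.tm.initialState m₁ (fun _ => [])
    [] ((T.readWord T.readStart i).reverse ++ [T.head]) (List.replicate i.length () ++ [()]) []
  have e₁ : ((T.readWord T.readStart i).reverse ++ [T.head]).reverse ++ [] = T.word i := by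
    simp [RowTransducer.word]
  have e₂ : List.replicate i.length () ++ [()] = List.replicate (i.length + 1) () := by
    rw [List.replicate_succ']
  rw [e₁, e₂] at h₂
  rw [e₂] at h₁
  obtain ⟨m₃, w', hw', h₃⟩ := rows_run T M.tm.initialState m₂ (fun _ => []) (i.length + 1)
    (T.word i) []
  rw [← hR, List.append_nil] at h₃
  obtain ⟨m₄, h₄⟩ := flush_run T M.tm.initialState m₃ w' R.reverse []
  rw [List.reverse_reverse, List.append_nil, Function.update_eq_self_iff.2 rfl] at h₄
  obtain ⟨m₅, h₅⟩ := clear_run T M.tm.initialState m₄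
    (Function.update (fun _ => []) M.tm.k₀ (R.map M.inputAlphabet.symm)) w'
  have h₆ := stepsTo_embed T M m₅ n _ _ hM
  have h₇ := wipe_run T M.tm.initialState { m₅ with bit := some b } b rfl
    (y.map M.outputAlphabet.symm)
  have h₀ : step T M ⟨some (.inr .start), (M.tm.initialState, Memory.init T),
      contents M (fun _ => []) i [] [] [] [] []⟩ =
      some ⟨some (.inr .read), (M.tm.initialState, ⟨T.readStart, none, none, none⟩),
        contents M (fun _ => []) i [] [T.head] [()] [] []⟩ := by
    simp [step, program, update_done, update_count, contents, Memory.init]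
  have h₈ : StepsTo (step T M) 1 (embed M m₅ ⟨none, M.tm.initialState, Function.update (fun _ => [])
      M.tm.k₁ ((b :: y).map M.outputAlphabet.symm)⟩) _ :=
    StepsTo.single (b := ⟨some (.inr .wipe), (M.tm.initialState, { m₅ with bit := some b }),
      contents M (Function.update (fun _ => []) M.tm.k₁ (y.map M.outputAlphabet.symm))
        [] [] [] [] [] []⟩) (by
      simp [step, program, embed, update_inl, contents])
  have total := StepsTo.head h₀
    ((((((h₁.trans h₂).trans h₃).trans h₄).trans h₅).trans h₆).trans (h₈.trans h₇))
  simp only [List.length_append, List.length_reverse, T.length_readWord, List.length_map,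
    List.length_singleton, hlen, hw'] at total
  have start : contents (A := A) M (fun _ => []) i [] [] [] [] [] =
      Function.update (β := fun k => List (Alphabet A M k)) (fun _ => []) (Sum.inr LocalStack.input) i := by
    funext k
    rcases k with k | k <;> [skip; cases k] <;> simp [contents]
  have finish : contents (A := A) M (fun _ => []) [] [] [] [] [] [!b] =
      Function.update (β := fun k => List (Alphabet A M k)) (fun _ => []) (Sum.inr LocalStack.answer) [!b] := by
    funext k
    rcases k with k | k <;> [skip; cases k] <;> simp [contents]
  rw [start, finish] at total
  have hnt' : n ≤ t := hnt
  have input : i.map (machine T M).inputAlphabet.invFun = i := List.map_id i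
  -- With `L = i.length`, the phases add up to `2 L ^ 2 + 10 L + 15 + R.length + n + y.length`
  -- steps.
  refine outputsInTime_of_stepsTo (machine T M) (by rw [input]; exact total) ?_
  nlinarith

end RowSolver

/-! ### The Hamiltonian of a formula

The Hamiltonian has one variable per symbol of the encoding of the formula, and an additional first
one.  The *role* of a variable determines its weights. -/

/-- The roles of the variables of the Hamiltonian of a formula: the guard, which is set in the ground
states if and only if the formula is unsatisfiable; the variables of the formula; the opening
bracket of the clause `c`, which selects the guard as a witness of the clause; the commas that close
a literal of the clause `c`, which select the literal as a witness; and the symbols that play no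
role, among which we distinguish the unary digits of the literals and the closing brackets. -/
inductive Role
  | guard
  | var (i : ℕ)
  | pad
  | start (c : ℕ)
  | tick (j : ℕ)
  | lit (c i : ℕ) (s : Bool)
  | close

namespace Role

/-- The weight of the linear term. -/
def diag : Role → ℤ
  | guard => 1
  | lit _ _ s => if s then 0 else -2
  | _ => 0

/-- The weight of the quadratic term. -/
def coupling : Role → Role → ℤ
  | guard, start _ => -2
  | var i, lit _ j s => if i = j then (if s then -2 else 2) else 0
  | start c, lit c' _ _ => if c = c' then 4 else 0
  | lit c _ _, lit c' _ _ => if c = c' then 4 else 0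
  | _, _ => 0

/-- The roles of the symbols of a literal in the clause `c`. -/
def ofLiteral (c : ℕ) (l : ℕ × Bool) : List Role :=
  pad :: (List.range l.1).map tick ++ [lit c l.1 l.2]

/-- The roles of the symbols of the clause `c`. -/
def ofClause (c : ℕ) (cl : List (ℕ × Bool)) : List Role :=
  start c :: cl.flatMap (ofLiteral c) ++ [close]

/-- The roles of the symbols of a list of clauses, numbered from `c` on. -/
def ofClauses : ℕ → List (List (ℕ × Bool)) → List Role
  | _, [] => []
  | c, cl :: cls => ofClause c cl ++ ofClauses (c + 1) cls

/-- The rows of the weight matrix for a list of roles, with `d` zeros in front. -/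
def matrixRows : ℕ → List Role → List (List ℤ)
  | _, [] => []
  | d, a :: l => (List.replicate d 0 ++ a.diag :: l.map a.coupling) :: matrixRows (d + 1) l

end Role

namespace CNFFormula

/-- The clauses of a formula, with numbers as variables. -/
def natClauses (φ : CNFFormula) : List (List (ℕ × Bool)) :=
  φ.clauses.map fun c => c.map fun l => ((l.1 : ℕ), l.2)

/-- The roles of the variables of the Hamiltonian of a formula. -/
def roles (φ : CNFFormula) : List Role :=
  Role.guard :: (List.range φ.n).map Role.var ++ Role.pad :: Role.ofClauses 0 φ.natClauses

/-- The Hamiltonian of a formula. -/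
def toQUBO (φ : CNFFormula) : QUBO where
  n := φ.roles.length
  weight i j :=
    if i < j then (φ.roles.get i).coupling (φ.roles.get j)
    else if i = j then (φ.roles.get i).diag else 0
  upper i j h := by rw [if_neg (by omega), if_neg (by omega)]

end CNFFormula

/-! ### The transducer that writes the Hamiltonian -/

/-- The symbols of a formula, as they are kept while the rows of the weight matrix are written:
every row after that of a variable `i` of the formula has removed one unary digit of each literal,
and marked the literals with the variable `i`; the symbols whose row has been written are dead. -/
inductive Letter
  | guard | var | pad | start | tick | lit (s : Bool) | marked (s : Bool) | close | dead

instance : Fintype Letter where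
  elems := ⟨↑[Letter.guard, .var, .pad, .start, .tick, .lit false, .lit true, .marked false,
    .marked true, .close, .dead], by simp⟩
  complete x := by rcases x with _ | _ | _ | _ | _ | (_ | _) | (_ | _) | _ | _ <;> simp

/-- The states of the transducer: the first three occur while the formula is read, the others while
a row is written. -/
inductive PassState
  | header | clause | literal (s : Bool)
  | before | guardRow | varRow (seen : Bool) | mates | zeros

instance : Fintype PassState where
  elems := ⟨↑[PassState.header, .clause, .literal false, .literal true, .before, .guardRow,
    .varRow false, .varRow true, .mates, .zeros], by simp⟩
  complete x := by rcases x with _ | _ | (_ | _) | _ | _ | (_ | _) | _ | _ <;> simp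

namespace PassState

/-- Reading a symbol of the formula. -/
def read : PassState → Γ' → PassState × Letter
  | header, .bit _ => (header, .var)
  | header, .comma => (clause, .pad)
  | clause, .bra => (clause, .start)
  | clause, .ket => (clause, .close)
  | clause, .bit s => (literal s, .pad)
  | literal s, .bit _ => (literal s, .tick)
  | literal s, .comma => (clause, .lit s)
  | q, _ => (q, .pad)

/-- The first letter that is not dead selects the kind of the row and its diagonal entry. -/
def enter : Letter → PassState × Letter × ℤ
  | .dead => (before, .dead, 0)
  | .guard => (guardRow, .dead, 1)
  | .var => (varRow false, .dead, 0)
  | .start => (mates, .dead, 0)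
  | .lit s => (mates, .dead, if s then 0 else -2)
  | .marked s => (mates, .dead, if s then 0 else -2)
  | _ => (zeros, .dead, 0)

/-- The transition during a row: the new state, the new letter and the entry of the matrix. -/
def move : PassState → Letter → PassState × Letter × ℤ
  | before, a => enter a
  | guardRow, .start => (guardRow, .start, -2)
  | varRow false, .tick => (varRow true, .pad, 0)
  | varRow false, .lit s => (varRow false, .marked s, if s then -2 else 2)
  | varRow true, .lit s => (varRow false, .lit s, 0)
  | mates, .lit s => (mates, .lit s, 4)
  | mates, .marked s => (mates, .marked s, 4)
  | mates, .close => (zeros, .close, 0)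
  | q, a => (q, a, 0)

theorem abs_move_le (q : PassState) (a : Letter) : |(move q a).2.2| ≤ 4 := by
  rcases q with _ | _ | (_ | _) | _ | _ | (_ | _) | _ | _ <;>
    rcases a with _ | _ | _ | _ | _ | (_ | _) | (_ | _) | _ | _ <;> simp [move, enter]

end PassState

/-- A sign bit, at most three binary digits and a comma. -/
theorem length_encodeInt_le {z : ℤ} (hz : |z| ≤ 4) : (encodeInt z).length ≤ 5 := by
  obtain ⟨h₁, h₂⟩ := abs_le.1 hz
  interval_cases z <;> decide

/-- The transducer that writes the Hamiltonian of a formula. -/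
def quboWriter : RowTransducer Letter PassState where
  head := .guard
  readStart := .header
  read := PassState.read
  rowStart := .before
  step q a := ((q.move a).1, (q.move a).2.1, encodeInt (q.move a).2.2)
  length_le q a := length_encodeInt_le (q.abs_move_le a)

/-- The letter of a role after `i` rows of variables of the formula. -/
def Role.letter (i : ℕ) : Role → Letter
  | guard => .guard
  | var _ => .var
  | pad => .pad
  | start _ => .start
  | tick j => if j < i then .pad else .tick
  | lit _ j s => if j < i then .marked s else .lit s
  | close => .close

namespace QUBOWriter

open Role PassState

/-- The text of a list of entries. -/
def entries (r : List ℤ) : List Γ' := (r.map encodeInt).flatten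

theorem entries_append (r r' : List ℤ) : entries (r ++ r') = entries r ++ entries r' := by
  simp [entries]

theorem entries_cons (z : ℤ) (r : List ℤ) : entries (z :: r) = encodeInt z ++ entries r := by
  simp [entries]

/-- The text of a row. -/
def rowText (r : List ℤ) : List Γ' := Γ'.bra :: entries r ++ [Γ'.ket]

/-! #### Reading -/

theorem read_header (n : ℕ) (w : List Γ') :
    quboWriter.readWord header ((unaryEncodeNat n).map Γ'.bit ++ w) =
      List.replicate n Letter.var ++ quboWriter.readWord header w := by
  induction n with
  | zero => rfl
  | succ n ih =>
    simp only [unaryEncodeNat, List.map_cons, List.cons_append, RowTransducer.readWord,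
      List.replicate_succ]
    rw [← ih]; rfl

theorem read_ticks (s : Bool) (n : ℕ) (w : List Γ') :
    quboWriter.readWord (literal s) ((unaryEncodeNat n).map Γ'.bit ++ w) =
      List.replicate n Letter.tick ++ quboWriter.readWord (literal s) w := by
  induction n with
  | zero => rfl
  | succ n ih =>
    simp only [unaryEncodeNat, List.map_cons, List.cons_append, RowTransducer.readWord,
      List.replicate_succ]
    rw [← ih]; rfl

theorem map_letter_ticks (n : ℕ) :
    ((List.range n).map tick).map (letter 0) = List.replicate n Letter.tick := by
  rw [List.eq_replicate_iff]; simp [letter]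

theorem map_letter_vars (n i : ℕ) :
    ((List.range n).map var).map (letter i) = List.replicate n Letter.var := by
  rw [List.eq_replicate_iff]; simp [letter]

/-- The clause number `c` is arbitrary because letters do not record it. Clauses are told apart by
their brackets alone. -/
theorem read_literals {n : ℕ} (c : ℕ) (cl : List (Fin n × Bool)) (w : List Γ') :
    quboWriter.readWord clause ((cl.map encodeLiteral).flatten ++ w) =
      ((cl.map fun l => ((l.1 : ℕ), l.2)).flatMap (ofLiteral c)).map (letter 0) ++
        quboWriter.readWord clause w := by
  induction cl with
  | nil => rfl
  | cons l cl ih =>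
    simp only [List.map_cons, List.flatten_cons, List.flatMap_cons, List.map_append,
      List.append_assoc, ← ih]
    simp only [encodeLiteral, ofLiteral, List.cons_append, List.map_cons, List.append_assoc,
      List.map_append, map_letter_ticks, List.nil_append, List.map_nil]
    rw [RowTransducer.readWord]
    change Letter.pad :: quboWriter.readWord (literal l.2) _ = _
    rw [read_ticks]
    rfl

theorem read_clauses {n : ℕ} (c : ℕ) (cls : List (List (Fin n × Bool))) :
    quboWriter.readWord clause
      (cls.map fun c => Γ'.bra :: (c.map encodeLiteral).flatten ++ [Γ'.ket]).flatten =
      (ofClauses c (cls.map fun c => c.map fun l => ((l.1 : ℕ), l.2))).map (letter 0) := by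
  induction cls generalizing c with
  | nil => rfl
  | cons cl cls ih =>
    simp only [List.map_cons, List.flatten_cons, ofClauses, List.map_append, ← ih, ofClause,
      List.cons_append, List.append_assoc]
    rw [RowTransducer.readWord]
    change Letter.start :: quboWriter.readWord clause _ = _
    rw [read_literals c]
    rfl

/-- Roles are laid out symbol by symbol as in the encoding, with the guard in front, so a letterwise
translation produces the initial word. -/
theorem word_encode (φ : CNFFormula) :
    quboWriter.word φ.encode = φ.roles.map (letter 0) := by
  simp only [RowTransducer.word, CNFFormula.encode, CNFFormula.roles, List.map_append,
    List.map_cons, List.cons_append]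
  change Letter.guard :: quboWriter.readWord header _ = _
  rw [read_header, map_letter_vars, RowTransducer.readWord]
  change _ :: (_ ++ _ :: quboWriter.readWord clause _) = _
  have h := read_clauses 0 φ.clauses
  simp only [List.cons_append] at h
  rw [h]
  rfl

/-! #### Writing -/

/-- The passes that start in the state `q` write the entries `r` for the roles `l`, turn the letters
after `i` rows into those after `j` rows, and end in the state `q'`. -/
def Passes (q : PassState) (i : ℕ) (l : List Role) (r : List ℤ) (j : ℕ) (q' : PassState) : Prop :=
  ∀ W, quboWriter.emit q (l.map (letter i) ++ W) = entries r ++ quboWriter.emit q' W ∧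
    quboWriter.rewrite q (l.map (letter i) ++ W) = l.map (letter j) ++ quboWriter.rewrite q' W

namespace Passes

theorem nil (q : PassState) (i j : ℕ) : Passes q i [] [] j q := fun _ => ⟨rfl, rfl⟩

theorem append {q q' q'' : PassState} {i j : ℕ} {l l' : List Role} {r r' : List ℤ}
    (h : Passes q i l r j q') (h' : Passes q' i l' r' j q'') :
    Passes q i (l ++ l') (r ++ r') j q'' := fun W => by
  simp only [List.map_append, List.append_assoc, entries_append, (h _).1, (h _).2, (h' _).1,
    (h' _).2, and_self]

theorem single {q q' : PassState} {i j : ℕ} {a : Role} {z : ℤ}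
    (h : q.move (a.letter i) = (q', a.letter j, z)) : Passes q i [a] [z] j q' := fun W => by
  simp [RowTransducer.emit, RowTransducer.rewrite, quboWriter, h, entries]

theorem of_forall {q : PassState} {i : ℕ} {l : List Role} {f : Role → ℤ}
    (h : ∀ a ∈ l, q.move (a.letter i) = (q, a.letter i, f a)) :
    Passes q i l (l.map f) i q := by
  induction l with
  | nil => exact nil _ _ _
  | cons a l ih =>
    exact (single (h a (by simp))).append (ih fun b hb => h b (by simp [hb]))

end Passes

/-! ### Passes for the kinds of rows -/

theorem passes_zeros (i : ℕ) (l : List Role) (f : Role → ℤ) (hf : ∀ b ∈ l, f b = 0) :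
    Passes zeros i l (l.map f) i zeros :=
  .of_forall fun a ha => by rw [hf a ha]; rfl

theorem passes_guardRow (i : ℕ) (l : List Role) :
    Passes guardRow i l (l.map guard.coupling) i guardRow :=
  .of_forall fun a _ => by
    cases a <;> simp [letter, coupling, move] <;> split_ifs <;> rfl

/-- Digits below `i` are already gone, so the first remaining one is digit `i`. It is removed, the
later ones are skipped, and the final state records whether there was one, that is, whether the
index exceeds `i`. -/
theorem passes_varRow_ticks (i n : ℕ) :
    Passes (varRow false) i ((List.range n).map tick)
      (((List.range n).map tick).map (var i).coupling) (i + 1) (varRow (decide (i < n))) := by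
  induction n with
  | zero => exact .nil _ _ _
  | succ n ih =>
    rw [List.range_succ, List.map_append, List.map_append]
    refine ih.append (.single ?_)
    rcases lt_trichotomy n i with h | rfl | h
    · simp [letter, h, h.not_gt, move, coupling, Nat.lt_succ_of_lt h, Nat.not_lt.2 h]
    · simp [letter, move, coupling]
    · simp [letter, h, h.not_gt, move, coupling, Nat.lt_succ_of_lt h, Nat.not_lt.2 h]

/-- The three cases of the index: below `i` the literal is marked and ignored; at `i` it is unmarked
without digits left, so it receives its entry and is marked; above `i` a digit was seen, which
suppresses the entry. -/
theorem passes_varRow_literal (i c : ℕ) (l : ℕ × Bool) :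
    Passes (varRow false) i (ofLiteral c l) ((ofLiteral c l).map (var i).coupling) (i + 1)
      (varRow false) := by
  unfold ofLiteral
  rw [List.map_append, List.map_cons]
  refine .append (.append (l := [pad]) (r := [0]) (.single rfl) (passes_varRow_ticks i l.1)) ?_
  refine .single ?_
  rcases lt_trichotomy l.1 i with h | h | h
  · simp [letter, h, h.not_gt, h.ne', move, coupling, Nat.lt_succ_of_lt h]
  · subst h; simp [letter, move, coupling]
  · simp [letter, h, h.not_gt, h.ne, move, coupling, Nat.not_lt.2 h]

theorem passes_varRow_clauses (i c : ℕ) (cls : List (List (ℕ × Bool))) :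
    Passes (varRow false) i (ofClauses c cls) ((ofClauses c cls).map (var i).coupling) (i + 1)
      (varRow false) := by
  induction cls generalizing c with
  | nil => exact .nil _ _ _
  | cons cl cls ih =>
    rw [ofClauses, List.map_append]
    refine .append ?_ (ih _)
    rw [ofClause, List.map_append, List.map_cons]
    refine .append (.append (l := [start c]) (r := [0]) (.single (q := varRow false) rfl) ?_)
      (.single (q := varRow false) rfl)
    induction cl with
    | nil => exact .nil _ _ _
    | cons l cl ih' =>
      rw [List.flatMap_cons, List.map_append]
      exact .append (passes_varRow_literal i c l) ih'

theorem passes_varRow (i m : ℕ) (js : List ℕ) (cls : List (List (ℕ × Bool))) :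
    Passes (varRow false) i (js.map var ++ pad :: ofClauses m cls)
      ((js.map var ++ pad :: ofClauses m cls).map (var i).coupling) (i + 1) (varRow false) := by
  rw [List.map_append, List.map_cons]
  refine .append ?_ (.append (l := [pad]) (r := [0]) (.single (q := varRow false) rfl)
    (passes_varRow_clauses i m cls))
  induction js with
  | nil => exact .nil _ _ _
  | cons j js ih => exact .append (l := [var j]) (r := [0]) (.single (q := varRow false) rfl) ih

/-- The transducer writes the rows of the weight matrix for the last roles `l` correctly, if it is
started after `i` rows of variables of the formula. -/
def WritesRows (i : ℕ) (l : List Role) : Prop :=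
  ∀ d, quboWriter.rows l.length (List.replicate d Letter.dead ++ l.map (letter i)) =
    (matrixRows d l).flatMap rowText

theorem WritesRows.nil (i : ℕ) : WritesRows i [] := fun _ => rfl

/-- The progress `i` matters only for the couplings in variable rows; neither the diagonal nor the
dead mark depends on it. -/
theorem enter_letter (i : ℕ) (a : Role) :
    (enter (a.letter i)).2 = (.dead, a.diag) := by
  rcases a with _ | _ | _ | _ | j | ⟨c, j, s⟩ | _ <;> try rfl
  all_goals by_cases h : j < i <;> simp [letter, h, enter, diag]

theorem pass_dead (d : ℕ) (W : List Letter) :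
    quboWriter.emit before (List.replicate d Letter.dead ++ W) =
        entries (List.replicate d 0) ++ quboWriter.emit before W ∧
      quboWriter.rewrite before (List.replicate d Letter.dead ++ W) =
        List.replicate d Letter.dead ++ quboWriter.rewrite before W := by
  induction d with
  | zero => exact ⟨rfl, rfl⟩
  | succ d ih =>
    simp only [List.replicate_succ, List.cons_append, RowTransducer.emit, RowTransducer.rewrite,
      entries_cons, List.append_assoc]
    rw [← ih.1, ← ih.2]
    exact ⟨rfl, rfl⟩

/-- The dead prefix supplies the zeros left of the diagonal. The letter of `a` dies in this pass, so
the next row has one more leading zero. -/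
theorem WritesRows.cons {i j : ℕ} {a : Role} {l : List Role} {q : PassState}
    (h : Passes (enter (a.letter i)).1 i l (l.map a.coupling) j q) (hl : WritesRows j l) :
    WritesRows i (a :: l) := fun d => by
  have hd := pass_dead d ((a :: l).map (letter i))
  have ha : quboWriter.step before (a.letter i) =
      ((enter (a.letter i)).1, .dead, encodeInt a.diag) := by
    simp only [quboWriter, move, enter_letter i a]
  have h' := h []
  simp only [List.append_nil, RowTransducer.emit, RowTransducer.rewrite] at h'
  simp only [List.map_cons, RowTransducer.emit, RowTransducer.rewrite, ha, h'.1, h'.2] at hd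
  rw [List.length_cons, RowTransducer.rows, matrixRows, List.flatMap_cons, ← hl (d + 1)]
  change Γ'.bra :: quboWriter.emit before _ ++ Γ'.ket :: quboWriter.rows _
    (quboWriter.rewrite before _) = _
  simp only [List.map_cons, hd.1, hd.2, rowText, entries_append, entries_cons,
    List.replicate_succ', List.append_assoc, List.cons_append, List.nil_append]

/-- The roles inside the brackets of the clause `c`. -/
def Inner (c : ℕ) : Role → Prop
  | pad => True
  | tick _ => True
  | lit c' _ _ => c' = c
  | _ => False

theorem inner_of_mem {c : ℕ} {cl : List (ℕ × Bool)} {b : Role}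
    (hb : b ∈ cl.flatMap (ofLiteral c)) : Inner c b := by
  simp only [List.mem_flatMap, ofLiteral, List.mem_append, List.mem_cons, List.mem_map,
    List.not_mem_nil, or_false] at hb
  obtain ⟨l, -, (rfl | ⟨j, -, rfl⟩) | rfl⟩ := hb <;> simp [Inner]

/-- A role that belongs to the clause `c`. -/
def Member (c : ℕ) : Role → Prop
  | start c' => c' = c
  | lit c' _ _ => c' = c
  | _ => False

/-- Clauses are numbered increasingly. This is what makes different clauses uncoupled. -/
theorem le_of_mem_ofClauses {c c' : ℕ} {cls : List (List (ℕ × Bool))} {b : Role}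
    (hb : b ∈ ofClauses c cls) (h : Member c' b) : c ≤ c' := by
  induction cls generalizing c with
  | nil => simp [ofClauses] at hb
  | cons cl cls ih =>
    simp only [ofClauses, ofClause, List.cons_append, List.mem_cons, List.mem_append,
      List.not_mem_nil, or_false] at hb
    rcases hb with rfl | (hb | rfl) | hb
    · exact le_of_eq h
    · have := inner_of_mem hb
      cases b <;> simp_all [Inner, Member]
    · simp [Member] at h
    · have := ih hb; omega

/-- A selector is penalized against every later selector up to the closing bracket of its clause. No
selector beyond it carries the same clause number, so zeros are correct from there on. -/
theorem passes_mates {i c : ℕ} {a : Role} {rest later : List Role} (ha : Member c a)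
    (hrest : ∀ b ∈ rest, Inner c b) (hlater : ∀ b ∈ later, ¬ Member c b) :
    Passes mates i (rest ++ close :: later) ((rest ++ close :: later).map a.coupling) i zeros := by
  rw [List.map_append, List.map_cons]
  refine .append (.of_forall fun b hb => ?_) (.append (l := [close]) (r := [_]) (.single ?_)
    (passes_zeros _ _ _ fun b hb => ?_))
  · have := hrest b hb
    cases a <;> cases b <;> simp_all [Inner, Member, coupling, letter, move] <;> split_ifs <;> rfl
  · cases a <;> rfl
  · have := hlater b hb
    cases a <;> cases b <;> simp_all [Member, coupling] <;> exact fun h => this h.symm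

theorem passes_pad {i : ℕ} {a : Role} (ha : ∀ b, a.coupling b = 0) (l : List Role) :
    Passes zeros i l (l.map a.coupling) i zeros :=
  passes_zeros i l _ fun b _ => ha b

/-- Induction over the suffixes of the clause: above the diagonal, a row depends only on the roles
after it. -/
theorem writesRows_rest {i c : ℕ} (rest later : List Role) (hrest : ∀ b ∈ rest, Inner c b)
    (hlater : ∀ b ∈ later, ¬ Member c b) (h : WritesRows i later) :
    WritesRows i (rest ++ close :: later) := by
  induction rest with
  | nil => exact .cons (passes_pad (fun _ => rfl) _) h
  | cons a rest ih =>
    have ih := ih fun b hb => hrest b (by simp [hb])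
    have ha := hrest a (by simp)
    rcases a with _ | _ | _ | _ | j | ⟨c', j, s⟩ | _ <;> try exact ha.elim
    · exact .cons (passes_pad (fun _ => rfl) _) ih
    · refine .cons (q := zeros) ?_ ih
      have : (enter (letter i (tick j))).1 = zeros := by
        simp only [letter]; split_ifs <;> rfl
      rw [this]
      exact passes_pad (fun _ => rfl) _
    · refine .cons (q := zeros) ?_ ih
      have : (enter (letter i (lit c' j s))).1 = mates := by
        simp only [letter]; split_ifs <;> rfl
      rw [this]
      exact passes_mates ha (fun b hb => hrest b (by simp [hb])) hlater

theorem writesRows_clauses (i c : ℕ) (cls : List (List (ℕ × Bool))) :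
    WritesRows i (ofClauses c cls) := by
  induction cls generalizing c with
  | nil => exact .nil i
  | cons cl cls ih =>
    have hrest : ∀ b ∈ cl.flatMap (ofLiteral c), Inner c b := fun b => inner_of_mem
    have hlater : ∀ b ∈ ofClauses (c + 1) cls, ¬ Member c b := fun b hb h => by
      have := le_of_mem_ofClauses hb h
      omega
    have h := writesRows_rest _ _ hrest hlater (ih (c + 1))
    rw [ofClauses, ofClause, List.append_assoc]
    exact .cons (passes_mates (c := c) rfl hrest hlater) h

/-- The range starts at `i` because the row of variable `i` comes after exactly `i` variable rows,
when a literal with this index has just lost its last digit. -/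
theorem writesRows_vars (i n : ℕ) (cls : List (List (ℕ × Bool))) :
    WritesRows i ((List.range' i n).map var ++ pad :: ofClauses 0 cls) := by
  induction n generalizing i with
  | zero => exact .cons (passes_pad (fun _ => rfl) _) (writesRows_clauses i 0 cls)
  | succ n ih =>
    rw [List.range'_succ, List.map_cons]
    exact .cons (passes_varRow i 0 _ cls) (ih (i + 1))

theorem rows_roles (φ : CNFFormula) :
    quboWriter.rows φ.roles.length (φ.roles.map (letter 0)) =
      (matrixRows 0 φ.roles).flatMap rowText := by
  have h := writesRows_vars 0 φ.n φ.natClauses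
  rw [← List.range_eq_range'] at h
  exact WritesRows.cons (a := guard) (passes_guardRow 0 _) h 0

theorem matrixRows_eq_ofFn (d : ℕ) (l : List Role) :
    matrixRows d l = List.ofFn fun i : Fin l.length => List.replicate d 0 ++
      List.ofFn fun j : Fin l.length =>
        if i < j then (l.get i).coupling (l.get j) else if i = j then (l.get i).diag else 0 := by
  induction l generalizing d with
  | nil => rfl
  | cons a l ih =>
    rw [matrixRows, ih, List.ofFn_succ]
    congr 1
    · rw [List.ofFn_succ]
      simp [List.ofFn_getElem_eq_map]
    · congr 1
      funext i
      rw [List.ofFn_succ]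
      simp [List.replicate_succ']

theorem encode_toQUBO (φ : CNFFormula) :
    quboWriter.rows (φ.encode.length + 1) (quboWriter.word φ.encode) = φ.toQUBO.encode := by
  have hl : φ.encode.length + 1 = φ.roles.length := by
    have := congrArg List.length (word_encode φ)
    simpa [RowTransducer.word, quboWriter.length_readWord] using this
  rw [hl, word_encode, rows_roles, matrixRows_eq_ofFn]
  rw [List.flatMap_def, List.map_ofFn]
  unfold QUBO.encode
  congr 2
  funext i
  simp only [Function.comp, rowText, entries, List.replicate_zero, List.nil_append, List.map_ofFn]
  rfl

end QUBOWriter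

/-! ### Ground states of the Hamiltonian of a formula -/

namespace Role

/-- The energy of an assignment to variables with the given roles, in an external field `F`. -/
def energy : (Role → ℤ) → List (Role × Bool) → ℤ
  | _, [] => 0
  | F, p :: z => p.2.toInt * (p.1.diag + F p.1) +
      energy (fun r => F r + p.2.toInt * p.1.coupling r) z

theorem energy_congr {F G : Role → ℤ} {z : List (Role × Bool)} (h : ∀ p ∈ z, F p.1 = G p.1) :
    energy F z = energy G z := by
  induction z generalizing F G with
  | nil => rfl
  | cons p z ih =>
    rw [energy, energy, h p (by simp)]
    congr 1
    exact ih fun q hq => by rw [h q (by simp [hq])]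

/-- The first block adds nothing to the field felt by the second. -/
theorem energy_append {F : Role → ℤ} {z z' : List (Role × Bool)}
    (h : ∀ p ∈ z, ∀ q ∈ z', p.1.coupling q.1 = 0) :
    energy F (z ++ z') = energy F z + energy F z' := by
  induction z generalizing F with
  | nil => simp [energy]
  | cons p z ih =>
    rw [List.cons_append, energy, energy, ih fun q hq => h q (by simp [hq]), add_assoc]
    congr 2
    exact energy_congr fun q hq => by simp [h p (by simp) q hq]

/-- Peeling off the first variable moves its couplings into the linear coefficients of the later
ones. -/
theorem energy_eq_sum (F : Role → ℤ) (l : List Role) (x : Fin l.length → Bool) :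
    energy F (List.ofFn fun i => (l.get i, x i)) =
      ∑ i, ((l.get i).diag + F (l.get i)) * (x i).toInt +
        ∑ i, ∑ j, if i < j then (l.get i).coupling (l.get j) * (x i).toInt * (x j).toInt else 0 := by
  induction l generalizing F with
  | nil => rfl
  | cons a l ih =>
    rw [List.ofFn_succ, energy]
    refine (congrArg _ (ih _ fun i => x i.succ)).trans ?_
    change _ = ∑ i : Fin (l.length + 1), _ + ∑ i : Fin (l.length + 1), ∑ j : Fin (l.length + 1), _
    rw [Fin.sum_univ_succ (n := l.length), Fin.sum_univ_succ (n := l.length)]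
    have hget (i : Fin l.length) : (a :: l).get i.succ = l.get i := rfl
    simp only [Fin.sum_univ_succ (n := l.length), List.get_cons_zero, hget,
      Fin.succ_lt_succ_iff, Fin.not_lt_zero, lt_irrefl, if_false, Fin.succ_pos, if_true, zero_add]
    simp only [← add_assoc, add_mul, Finset.sum_add_distrib]
    ring_nf

/-- No negative coupling starts at a role of a clause. -/
theorem coupling_nonneg {c : ℕ} {a : Role} (h : a = start c ∨ QUBOWriter.Inner c a ∨ a = close)
    (r : Role) : 0 ≤ a.coupling r := by
  rcases h with rfl | h | rfl
  · cases r <;> simp only [coupling, le_refl]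
    split_ifs <;> simp
  · cases a <;> cases r <;> simp_all [QUBOWriter.Inner, coupling]
    split_ifs <;> simp
  · rfl

/-- With nonnegative couplings the effective linear coefficients can only grow as variables are
processed. -/
theorem energy_nonneg {F : Role → ℤ} {z : List (Role × Bool)}
    (hF : ∀ p ∈ z, 0 ≤ p.1.diag + F p.1) (hc : ∀ p ∈ z, ∀ r, 0 ≤ p.1.coupling r) :
    0 ≤ energy F z := by
  induction z generalizing F with
  | nil => rfl
  | cons p z ih =>
    have hp : 0 ≤ p.2.toInt := by cases p.2 <;> simp
    refine add_nonneg (mul_nonneg hp (hF p (by simp))) (ih (fun q hq => ?_) fun q hq =>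
      hc q (by simp [hq]))
    have := hF q (by simp [hq])
    have := mul_nonneg hp (hc p (by simp) q.1)
    linarith

theorem energy_cons_of_uncoupled {F : Role → ℤ} {a : Role} {b : Bool} {z : List (Role × Bool)}
    (h : ∀ r, a.coupling r = 0) :
    energy F ((a, b) :: z) = b.toInt * (a.diag + F a) + energy F z := by
  rw [energy]
  congr 1
  exact energy_congr fun q _ => by simp [h]

/-- The external field that the guard and the variables of the formula exert on the clauses. -/
def field (u : Bool) (v : ℕ → Bool) : Role → ℤ
  | start _ => -2 * u.toInt
  | lit _ j s => (if s then -2 else 2) * (v j).toInt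
  | _ => 0

/-! ### Energy of a single clause -/

theorem neg_two_le_field (u : Bool) (v : ℕ → Bool) (r : Role) :
    -2 ≤ r.diag + field u v r := by
  rcases r with _ | _ | _ | _ | _ | ⟨c, j, s⟩ | _ <;> try simp [diag, field]
  · cases u <;> simp
  · cases s <;> cases v j <;> simp

/-- A literal is true. -/
def Holds (v : ℕ → Bool) (cl : List (ℕ × Bool)) : Prop := ∃ l ∈ cl, v l.1 = l.2

theorem field_nonneg {v : ℕ → Bool} {j : ℕ} {s : Bool} (c : ℕ) (h : v j ≠ s) :
    0 ≤ (lit c j s).diag + field false v (lit c j s) := by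
  cases s <;> cases hv : v j <;> simp_all [diag, field]

theorem field_eq {v : ℕ → Bool} {j : ℕ} {s : Bool} (u : Bool) (c : ℕ) (h : v j = s) :
    (lit c j s).diag + field u v (lit c j s) = -2 := by
  cases s <;> simp_all [diag, field]

/-- The first selector that is set gains at most `2`. Its penalty raises the coefficient of every
later selector from at least `-2` to at least `2`, so nothing further is gained. -/
theorem neg_two_le_energy_inner {c : ℕ} {u : Bool} {v : ℕ → Bool} {z : List (Role × Bool)}
    (hz : ∀ p ∈ z, QUBOWriter.Inner c p.1 ∨ p.1 = close) : -2 ≤ energy (field u v) z := by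
  induction z with
  | nil => simp [energy]
  | cons p z ih =>
    have ih' := ih fun q hq => hz q (by simp [hq])
    obtain ⟨a, b⟩ := p
    have uncoupled (h₁ : a.diag + field u v a = 0) (h₂ : ∀ r, a.coupling r = 0) :
        -2 ≤ energy (field u v) ((a, b) :: z) := by
      rwa [energy_cons_of_uncoupled h₂, h₁, mul_zero, zero_add]
    have ha := hz (a, b) (by simp)
    rcases a with _ | _ | _ | _ | j | ⟨c', j, s⟩ | _ <;>
      simp only [QUBOWriter.Inner, reduceCtorEq, or_false, or_true] at ha
    · exact uncoupled rfl fun _ => rfl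
    · exact uncoupled rfl fun _ => rfl
    · subst ha
      rw [energy]
      cases b with
      | false => simpa using ih'
      | true =>
        have h₁ := neg_two_le_field u v (lit c' j s)
        have h₂ : 0 ≤ energy
            (fun r => field u v r + (true).toInt * (lit c' j s).coupling r) z := by
          refine energy_nonneg (fun q hq => ?_) fun q hq =>
            coupling_nonneg (.inr (hz q (by simp [hq])))
          have := neg_two_le_field u v q.1
          have hq' := hz q (by simp [hq])
          rcases q with ⟨_ | _ | _ | _ | _ | ⟨c, i, t⟩ | _, b⟩ <;>
            simp_all [QUBOWriter.Inner, diag, field, coupling]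
          linarith
        simp only [Bool.toInt_true, one_mul] at h₂ ⊢
        linarith
    · exact uncoupled rfl fun _ => rfl

theorem inner_of_map_fst {c : ℕ} {cl : List (ℕ × Bool)} {z : List (Role × Bool)}
    (hz : z.map Prod.fst = cl.flatMap (ofLiteral c) ++ [close]) :
    ∀ p ∈ z, QUBOWriter.Inner c p.1 ∨ p.1 = close := fun p hp => by
  have : p.1 ∈ cl.flatMap (ofLiteral c) ++ [close] := hz ▸ List.mem_map_of_mem hp
  rw [List.mem_append, List.mem_singleton] at this
  exact this.imp_left QUBOWriter.inner_of_mem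

/-- The energy of a clause is at least `-2`. -/
theorem neg_two_le_energy {c : ℕ} {u : Bool} {v : ℕ → Bool} {cl : List (ℕ × Bool)}
    {z : List (Role × Bool)} (hz : z.map Prod.fst = ofClause c cl) :
    -2 ≤ energy (field u v) z := by
  rw [ofClause, List.cons_append] at hz
  obtain ⟨⟨a, b⟩, z, rfl, rfl, hz'⟩ := List.map_eq_cons_iff.1 hz
  have hi := inner_of_map_fst hz'
  rw [energy]
  cases b with
  | false => simpa using neg_two_le_energy_inner hi
  | true =>
    have h₁ := neg_two_le_field u v (start c)
    have h₂ : 0 ≤ energy (fun r => field u v r + (true).toInt * (start c).coupling r) z := by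
      refine energy_nonneg (fun q hq => ?_) fun q hq => coupling_nonneg (.inr (hi q hq))
      have := neg_two_le_field u v q.1
      have hq' := hi q hq
      rcases q with ⟨_ | _ | _ | _ | _ | ⟨c, i, t⟩ | _, b⟩ <;>
        simp_all [QUBOWriter.Inner, diag, field, coupling]
      linarith
    simp only [Bool.toInt_true, one_mul] at h₂ ⊢
    linarith

/-- The energy of a clause without true literal is nonnegative, unless the guard is set. -/
theorem energy_nonneg_of_not_holds {c : ℕ} {v : ℕ → Bool} {cl : List (ℕ × Bool)}
    {z : List (Role × Bool)} (hz : z.map Prod.fst = ofClause c cl) (h : ¬ Holds v cl) :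
    0 ≤ energy (field false v) z := by
  have hmem : ∀ p ∈ z, p.1 ∈ ofClause c cl := fun p hp => hz ▸ List.mem_map_of_mem hp
  refine energy_nonneg (fun p hp => ?_) fun p hp => coupling_nonneg (c := c) ?_
  · have := hmem p hp
    simp only [ofClause, List.mem_append, List.mem_cons, List.mem_flatMap, ofLiteral, List.mem_map,
      List.not_mem_nil, or_false, List.cons_append] at this
    generalize p.1 = a at this
    obtain rfl | ⟨l, hl, rfl | ⟨j, -, rfl⟩ | rfl⟩ | rfl := this
    · exact le_refl 0
    · exact le_refl 0
    · exact le_refl 0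
    · exact field_nonneg c fun h'' => h ⟨l, hl, h''⟩
    · exact le_refl 0
  · have := hmem p hp
    simp only [ofClause, List.mem_append, List.mem_cons, List.not_mem_nil, or_false,
      List.cons_append] at this
    exact this.imp_right (Or.imp_left QUBOWriter.inner_of_mem)

theorem energy_map_false (F : Role → ℤ) (l : List Role) (z : List (Role × Bool)) :
    energy F (l.map (fun r => (r, false)) ++ z) = energy F z := by
  induction l with
  | nil => rfl
  | cons a l ih => simpa [energy] using ih

/-- The energy `-2` is attained by a clause with a true literal or if the guard is set. -/
theorem exists_energy_eq {u : Bool} {v : ℕ → Bool} {cl : List (ℕ × Bool)} (c : ℕ)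
    (h : u = true ∨ Holds v cl) :
    ∃ z, z.map Prod.fst = ofClause c cl ∧ energy (field u v) z = -2 := by
  -- A single set selector suffices: that of the guard or that of a true literal, whichever has
  -- effective weight `-2`.
  have key : ∃ l₁ r l₂, ofClause c cl = l₁ ++ r :: l₂ ∧ r.diag + field u v r = -2 := by
    rcases h with rfl | ⟨l, hl, h⟩
    · exact ⟨[], start c, _, rfl, rfl⟩
    · have : lit c l.1 l.2 ∈ ofClause c cl := by
        simp only [ofClause, List.mem_append, List.mem_cons, List.mem_flatMap, ofLiteral]
        exact .inl (.inr ⟨l, hl, by simp⟩)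
      obtain ⟨l₁, l₂, h'⟩ := List.append_of_mem this
      exact ⟨l₁, _, l₂, h', field_eq u c h⟩
  obtain ⟨l₁, r, l₂, h₁, h₂⟩ := key
  refine ⟨l₁.map (fun r => (r, false)) ++ (r, true) :: l₂.map (fun r => (r, false)), ?_, ?_⟩
  · simp [h₁, Function.comp_def]
  · have := energy_map_false (fun r' => field u v r' + (true).toInt * r.coupling r') l₂ []
    rw [List.append_nil] at this
    rw [energy_map_false, energy, this]
    simpa [energy] using h₂

/-! ### Energy of all clauses -/

theorem coupling_eq_zero {c : ℕ} {cl : List (ℕ × Bool)} {cls : List (List (ℕ × Bool))} {a b : Role}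
    (ha : a ∈ ofClause c cl) (hb : b ∈ ofClauses (c + 1) cls) : a.coupling b = 0 := by
  have hb' : ¬ QUBOWriter.Member c b := fun h => by
    have := QUBOWriter.le_of_mem_ofClauses hb h
    omega
  simp only [ofClause, List.mem_append, List.mem_cons, List.not_mem_nil, or_false,
    List.cons_append] at ha
  obtain rfl | ha | rfl := ha
  · cases b <;> simp_all [QUBOWriter.Member, coupling]
    exact fun h => hb' h.symm
  · have := QUBOWriter.inner_of_mem ha
    cases a <;> cases b <;> simp_all [QUBOWriter.Member, QUBOWriter.Inner, coupling]
    exact fun h => hb' h.symm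
  · rfl

theorem energy_append_clauses {c : ℕ} {cl : List (ℕ × Bool)} {cls : List (List (ℕ × Bool))}
    {z z' : List (Role × Bool)} (F : Role → ℤ) (hz : z.map Prod.fst = ofClause c cl)
    (hz' : z'.map Prod.fst = ofClauses (c + 1) cls) :
    energy F (z ++ z') = energy F z + energy F z' :=
  energy_append fun _ hp _ hq => coupling_eq_zero (hz ▸ List.mem_map_of_mem hp)
    (hz' ▸ List.mem_map_of_mem hq)

theorem neg_two_mul_le_energy {c : ℕ} {u : Bool} {v : ℕ → Bool} {cls : List (List (ℕ × Bool))}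
    {z : List (Role × Bool)} (hz : z.map Prod.fst = ofClauses c cls) :
    -2 * (cls.length : ℤ) ≤ energy (field u v) z := by
  induction cls generalizing c z with
  | nil => simp_all [ofClauses, energy]
  | cons cl cls ih =>
    obtain ⟨z₁, z₂, rfl, h₁, h₂⟩ := List.map_eq_append_iff.1 hz
    rw [energy_append_clauses _ h₁ h₂, List.length_cons]
    have := neg_two_le_energy (u := u) (v := v) h₁
    have := ih h₂
    push_cast
    linarith

theorem add_two_le_energy_of_not_holds {c : ℕ} {v : ℕ → Bool} {cls : List (List (ℕ × Bool))}
    {z : List (Role × Bool)} (hz : z.map Prod.fst = ofClauses c cls)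
    (h : ∃ cl ∈ cls, ¬ Holds v cl) :
    -2 * (cls.length : ℤ) + 2 ≤ energy (field false v) z := by
  induction cls generalizing c z with
  | nil => simp at h
  | cons cl cls ih =>
    obtain ⟨z₁, z₂, rfl, h₁, h₂⟩ := List.map_eq_append_iff.1 hz
    rw [energy_append_clauses _ h₁ h₂, List.length_cons]
    push_cast
    by_cases hcl : Holds v cl
    · have := neg_two_le_energy (u := false) (v := v) h₁
      have := ih h₂ (by
        obtain ⟨cl', hm, h'⟩ := h
        rcases List.mem_cons.1 hm with rfl | hm
        · exact absurd hcl h'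
        · exact ⟨cl', hm, h'⟩)
      linarith
    · have := energy_nonneg_of_not_holds h₁ hcl
      have := neg_two_mul_le_energy (u := false) (v := v) h₂
      linarith

theorem exists_energy_clauses_eq {u : Bool} {v : ℕ → Bool} {cls : List (List (ℕ × Bool))} (c : ℕ)
    (h : ∀ cl ∈ cls, u = true ∨ Holds v cl) :
    ∃ z, z.map Prod.fst = ofClauses c cls ∧ energy (field u v) z = -2 * (cls.length : ℤ) := by
  induction cls generalizing c with
  | nil => exact ⟨[], rfl, rfl⟩
  | cons cl cls ih =>
    obtain ⟨z₁, h₁, e₁⟩ := exists_energy_eq c (h cl (by simp))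
    obtain ⟨z₂, h₂, e₂⟩ := ih (c + 1) fun cl' h' => h cl' (by simp [h'])
    refine ⟨z₁ ++ z₂, by rw [List.map_append, h₁, h₂, ofClauses], ?_⟩
    rw [energy_append_clauses _ h₁ h₂, e₁, e₂, List.length_cons]
    push_cast
    ring

/-- The linear weights of formula variables vanish, so fixing them only creates a field. Variables
not yet processed exert none, hence the cutoff at `k`. -/
theorem energy_vars (u : Bool) (b : ℕ → Bool) (k m : ℕ) (z : List (Role × Bool)) :
    energy (field u fun i => if i < k then b i else false)
        ((List.range' k m).map (fun i => (var i, b i)) ++ z) =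
      energy (field u fun i => if i < k + m then b i else false) z := by
  induction m generalizing k with
  | zero => rfl
  | succ m ih =>
    rw [List.range'_succ, List.map_cons, List.cons_append, energy]
    have : (fun r => field u (fun i => if i < k then b i else false) r +
        (b k).toInt * (var k).coupling r) = field u fun i => if i < k + 1 then b i else false := by
      funext r
      rcases r with _ | _ | _ | _ | _ | ⟨c, j, s⟩ | _ <;> simp only [field, coupling, mul_zero,
        add_zero]
      rcases lt_trichotomy j k with h | h | h
      · simp [h, h.ne', Nat.lt_succ_of_lt h]
      · subst h; simp [mul_comm]
      · simp [h.not_gt, h.ne, Nat.not_lt.2 h]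
    have h₀ (v : ℕ → Bool) : (b k).toInt * ((var k).diag + field u v (var k)) = 0 := by
      simp [diag, field]
    change _ + energy (fun r => field u (fun i => if i < k then b i else false) r +
        (b k).toInt * (var k).coupling r) _ = _
    rw [h₀, zero_add, this, ih (k + 1), Nat.add_right_comm, Nat.add_assoc]

theorem exists_eq_map_vars {k m : ℕ} {z : List (Role × Bool)}
    (hz : z.map Prod.fst = (List.range' k m).map var) :
    ∃ b : ℕ → Bool, z = (List.range' k m).map fun i => (var i, b i) := by
  refine ⟨fun i => (z[i - k]?.map Prod.snd).getD false, ?_⟩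
  have hl : z.length = m := by simpa using congrArg List.length hz
  refine List.ext_getElem (by simp [hl]) fun i h₁ h₂ => ?_
  have : z[i].1 = var (k + i) := by
    have := List.getElem_of_eq hz (i := i) (by simpa using h₁)
    simpa using this
  simp [← this, h₁]

/-- The energy of an assignment for a formula. -/
theorem energy_roles (u b' : Bool) (b : ℕ → Bool) (n : ℕ) (z : List (Role × Bool)) :
    energy (fun _ => 0)
        ((guard, u) :: (List.range n).map (fun i => (var i, b i)) ++ (pad, b') :: z) =
      u.toInt + energy (field u fun i => if i < n then b i else false) z := by
  have h := energy_vars u b 0 n ((pad, b') :: z)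
  have h₀ : (fun r => 0 + u.toInt * guard.coupling r) =
      field u fun i => if i < 0 then b i else false := by
    funext r
    cases r <;> simp [field, coupling, mul_comm]
  have h₁ (F : Role → ℤ) : (fun r => F r + b'.toInt * pad.coupling r) = F := by
    funext r
    simp [coupling]
  rw [List.cons_append, energy, h₀, List.range_eq_range', h, energy, h₁]
  simp [diag, field]

end Role

namespace CNFFormula

open Role

variable (φ : CNFFormula)

theorem toQUBO_weight_self (i : Fin φ.roles.length) :
    φ.toQUBO.weight i i = (φ.roles.get i).diag := by
  change (if i < i then _ else if i = i then _ else 0) = _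
  rw [if_neg (lt_irrefl i), if_pos rfl]

theorem toQUBO_weight_of_lt {i j : Fin φ.roles.length} (h : i < j) :
    φ.toQUBO.weight i j = (φ.roles.get i).coupling (φ.roles.get j) :=
  if_pos h

theorem energy_toQUBO (x : Fin φ.roles.length → Bool) :
    φ.toQUBO.energy x =
      Role.energy (fun _ => 0) (List.ofFn fun i => (φ.roles.get i, x i)) := by
  rw [energy_eq_sum]
  change ∑ i : Fin φ.roles.length, φ.toQUBO.weight i i * (x i).toInt + ∑ i : Fin φ.roles.length,
    ∑ j ∈ Finset.Ioi i, φ.toQUBO.weight i j * (x i).toInt * (x j).toInt = _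
  congr 1
  · refine Finset.sum_congr rfl fun i _ => ?_
    rw [toQUBO_weight_self, add_zero]
  · refine Finset.sum_congr rfl fun i _ => ?_
    rw [← Finset.sum_filter]
    refine Finset.sum_congr (by ext j; simp) fun j hj => ?_
    rw [φ.toQUBO_weight_of_lt (Finset.mem_filter.1 hj).2]

theorem exists_ofFn_eq {l : List Role} {z : List (Role × Bool)} (hz : z.map Prod.fst = l) :
    ∃ x : Fin l.length → Bool, List.ofFn (fun i => (l.get i, x i)) = z := by
  subst hz
  refine ⟨fun i => (z.get (i.cast (by simp))).2, List.ext_getElem (by simp) fun i h₁ h₂ => ?_⟩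
  simp

/-- The cutoff at `φ.n` is the one in `energy_roles`, so the field there is that of a genuine
assignment. -/
theorem satisfiable_iff :
    φ.Satisfiable ↔ ∃ b : ℕ → Bool,
      ∀ cl ∈ φ.natClauses, Holds (fun i => if i < φ.n then b i else false) cl := by
  constructor
  · rintro ⟨a, ha⟩
    refine ⟨fun i => if h : i < φ.n then a ⟨i, h⟩ else false, fun cl hcl => ?_⟩
    obtain ⟨c, hc, rfl⟩ := List.mem_map.1 hcl
    obtain ⟨l, hl, h⟩ := ha c hc
    exact ⟨_, List.mem_map_of_mem hl, by simpa using h⟩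
  · rintro ⟨b, hb⟩
    refine ⟨fun i => b i, fun c hc => ?_⟩
    obtain ⟨l, hl, h⟩ := hb _ (List.mem_map_of_mem hc)
    obtain ⟨l, hl', rfl⟩ := List.mem_map.1 hl
    exact ⟨l, hl', by simpa using h⟩

theorem exists_energy_toQUBO_eq {u : Bool} {b : ℕ → Bool}
    (h : ∀ cl ∈ φ.natClauses, u = true ∨ Holds (fun i => if i < φ.n then b i else false) cl) :
    ∃ y, φ.toQUBO.energy y = u.toInt - 2 * (φ.natClauses.length : ℤ) := by
  obtain ⟨z, hz, e⟩ := exists_energy_clauses_eq 0 h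
  obtain ⟨y, hy⟩ := exists_ofFn_eq (l := φ.roles)
    (z := (guard, u) :: (List.range φ.n).map (fun i => (var i, b i)) ++ (pad, false) :: z)
    (by simp [hz, roles])
  refine ⟨y, ?_⟩
  rw [energy_toQUBO, hy, energy_roles, e]
  ring

/-- The guard is set in a ground state if and only if the formula is unsatisfiable. -/
theorem guard_of_isGroundState (x : Fin φ.roles.length → Bool) (hx : φ.toQUBO.IsGroundState x) :
    ∃ u y, List.ofFn x = u :: y ∧ ((!u) = true ↔ φ.Satisfiable) := by
  set z := List.ofFn fun i => (φ.roles.get i, x i) with hz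
  have hfst : z.map Prod.fst = φ.roles := by
    rw [hz, List.map_ofFn]
    exact List.ofFn_getElem
  have hsnd : z.map Prod.snd = List.ofFn x := by rw [hz, List.map_ofFn]; rfl
  have hE := φ.energy_toQUBO x
  rw [← hz] at hE
  rw [roles, List.cons_append] at hfst
  obtain ⟨⟨a, u⟩, z', hz', rfl, hfst⟩ := List.map_eq_cons_iff.1 hfst
  obtain ⟨z₁, z₂, rfl, h₁, h₂⟩ := List.map_eq_append_iff.1 hfst
  obtain ⟨⟨a, b'⟩, z₃, rfl, rfl, h₃⟩ := List.map_eq_cons_iff.1 h₂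
  rw [List.range_eq_range'] at h₁
  obtain ⟨b, rfl⟩ := exists_eq_map_vars h₁
  rw [hz', ← List.range_eq_range', ← List.cons_append, energy_roles] at hE
  refine ⟨u, _, by rw [← hsnd, hz']; rfl, ?_⟩
  rw [satisfiable_iff]
  constructor
  · intro hu
    obtain rfl : u = false := by simpa using hu
    -- An unset guard with a false clause costs at least `2 - 2 m`, but setting the guard attains `1
    -- - 2 m`.
    by_contra hsat
    push Not at hsat
    have hlow := add_two_le_energy_of_not_holds h₃ (hsat b)
    obtain ⟨y, hy⟩ := φ.exists_energy_toQUBO_eq (u := true) (b := b) (fun _ _ => .inl rfl)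
    have := hx y
    rw [hy, hE] at this
    simp only [Bool.toInt_true, Bool.toInt_false] at this
    linarith
  · rintro ⟨b₀, hb₀⟩
    cases u with
    | false => rfl
    | true =>
      -- A set guard costs at least `1 - 2 m`, but a satisfying assignment attains `-2 m` without
      -- it.
      have hlow := neg_two_mul_le_energy (u := true)
        (v := fun i => if i < φ.n then b i else false) h₃
      obtain ⟨y, hy⟩ := φ.exists_energy_toQUBO_eq (u := false) (fun cl hcl => .inr (hb₀ cl hcl))
      have := hx y
      rw [hy, hE] at this
      simp only [Bool.toInt_true, Bool.toInt_false] at this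
      linarith

end CNFFormula

/-! ### Treewidth of the Hamiltonian of a formula -/

/-- If the removal of `core` splits a graph into parts with at most `s` vertices, then its treewidth
is at most `core.card + s`. -/
theorem treewidth_le_of_parts {V ι : Type} [Fintype V] [DecidableEq V] [DecidableEq ι]
    (G : SimpleGraph V) (core : Finset V) (part : V → ι) (s : ℕ)
    (hG : ∀ u v, G.Adj u v → u ∈ core ∨ v ∈ core ∨ part u = part v)
    (hs : ∀ i, (Finset.univ.filter fun v => v ∉ core ∧ part v = i).card ≤ s) :
    treewidth G ≤ core.card + s := by
  classical
  -- The tree is a star: the core at the centre, and one leaf per part. Indexing the leaves by the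
  -- range of `part` keeps the tree finite. A core vertex lies in all bags, any other vertex in one
  -- leaf only.
  let bag : Option (Set.range part) → Finset V
    | none => core
    | some i => core ∪ Finset.univ.filter fun v => v ∉ core ∧ part v = i
  have core_subset : ∀ t, core ⊆ bag t := by
    rintro (_ | i)
    · exact subset_rfl
    · exact Finset.subset_union_left
  have mem_part (v : V) : v ∈ bag (some ⟨part v, v, rfl⟩) := by
    by_cases hv : v ∈ core <;> simp [bag, hv]
  have connected (v : V) :
      ((SimpleGraph.starGraph (none : Option (Set.range part))).induce
        {t | v ∈ bag t}).Connected := by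
    by_cases hv : v ∈ core
    · have : {t | v ∈ bag t} = Set.univ := Set.eq_univ_of_forall fun t => core_subset t hv
      rw [this]
      exact (SimpleGraph.induceUnivIso _).connected_iff.2 (SimpleGraph.connected_starGraph _)
    · have : {t | v ∈ bag t} = {some ⟨part v, v, rfl⟩} := by
        ext t
        rcases t with _ | ⟨i, hi⟩
        · simp [bag, hv]
        · simpa [bag, hv, Subtype.ext_iff] using eq_comm
      rw [this]
      exact { preconnected := fun a b => by rw [Subsingleton.elim a b]
              nonempty := ⟨⟨_, rfl⟩⟩ }
  let D : TreeDecomposition G :=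
    { Node := Option (Set.range part)
      fintypeNode := Fintype.ofFinite _
      tree := SimpleGraph.starGraph none
      isTree := SimpleGraph.isTree_starGraph none
      bag := bag
      connected := connected
      cover := fun u v h => by
        rcases hG u v h with hu | hv | h
        · exact ⟨some ⟨part v, v, rfl⟩, core_subset (some ⟨part v, v, rfl⟩) hu, mem_part v⟩
        · exact ⟨some ⟨part u, u, rfl⟩, mem_part u, core_subset (some ⟨part u, u, rfl⟩) hv⟩
        · refine ⟨some ⟨part u, u, rfl⟩, mem_part u, ?_⟩
          have := mem_part v
          simp only [← h] at this
          exact this }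
  have hcard (t : D.Node) : (D.bag t).card ≤ core.card + s := by
    rcases t with _ | i
    · exact Nat.le_add_right _ _
    · exact (Finset.card_union_le _ _).trans (Nat.add_le_add_left (hs i) _)
  calc treewidth G ≤ D.width := Nat.sInf_le ⟨D, rfl⟩
    _ ≤ core.card + s := (Nat.sub_le _ _).trans (Finset.sup_le fun t _ => hcard t)

theorem card_filter_get {α : Type} (l : List α) (P : α → Bool) :
    (Finset.univ.filter fun i => P (l.get i) = true).card = l.countP P := by
  induction l with
  | nil => rfl
  | cons a l ih =>
    rw [List.countP_cons, ← ih]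
    refine (Fin.card_filter_univ_succ (n := l.length) fun i => P ((a :: l).get i) = true).trans ?_
    by_cases h : P a = true <;> simp [h]

namespace Role

open QUBOWriter (Member)

/-- The decision procedure for membership in the clause `c`. -/
def isMember (c : ℕ) : Role → Bool
  | start c' => c' == c
  | lit c' _ _ => c' == c
  | _ => false

theorem isMember_iff {c : ℕ} {a : Role} : isMember c a = true ↔ Member c a := by
  cases a <;> simp [isMember, Member]

theorem countP_ofClause (c m : ℕ) (cl : List (ℕ × Bool)) :
    (ofClause m cl).countP (isMember c) = if m = c then cl.length + 1 else 0 := by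
  have h₁ (l : ℕ × Bool) : (ofLiteral m l).countP (isMember c) = if m = c then 1 else 0 := by
    simp [ofLiteral, List.countP_cons, List.countP_map, isMember, Function.comp_def]
  have h₂ : (cl.flatMap (ofLiteral m)).countP (isMember c) = if m = c then cl.length else 0 := by
    induction cl with
    | nil => simp
    | cons l cl ih =>
      rw [List.flatMap_cons, List.countP_append, ih, h₁]
      split_ifs <;> simp [Nat.add_comm]
  rw [ofClause, List.countP_append, List.countP_cons, h₂]
  by_cases h : m = c <;> simp [h, isMember]

theorem countP_ofClauses_le (c m k : ℕ) (cls : List (List (ℕ × Bool)))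
    (h : ∀ cl ∈ cls, cl.length ≤ k) : (ofClauses m cls).countP (isMember c) ≤ k + 1 := by
  induction cls generalizing m with
  | nil => simp [ofClauses]
  | cons cl cls ih =>
    rw [ofClauses, List.countP_append, countP_ofClause]
    split_ifs with hm
    · have : (ofClauses (m + 1) cls).countP (isMember c) = 0 := by
        refine List.countP_eq_zero.2 fun b hb hc => ?_
        have := QUBOWriter.le_of_mem_ofClauses hb (isMember_iff.1 hc)
        omega
      have := h cl (by simp)
      omega
    · rw [zero_add]
      exact ih _ fun cl' h' => h cl' (by simp [h'])

/-- The role that a selecting variable refers to. -/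
def partner : Role → Role
  | start _ => guard
  | lit _ j _ => var j
  | _ => pad

/-- The sparsity behind both treewidth bounds: a selector is coupled to earlier roles only through
what it selects and through its own clause. -/
theorem eq_partner_or_of_coupling_ne_zero {a b : Role} (h : a.coupling b ≠ 0) :
    ∃ c, Member c b ∧ (a = b.partner ∧ b.partner ≠ pad ∨ Member c a) := by
  rcases a with _ | _ | _ | _ | _ | _ | _ <;> rcases b with _ | _ | _ | _ | _ | _ | _ <;>
    simp_all [coupling, Member, partner]

theorem not_core_of_mem_ofClauses {m : ℕ} {cls : List (List (ℕ × Bool))} {a : Role}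
    (h : a ∈ ofClauses m cls) : a ≠ guard ∧ ∀ i, a ≠ var i := by
  induction cls generalizing m with
  | nil => simp [ofClauses] at h
  | cons cl cls ih =>
    simp only [ofClauses, ofClause, List.cons_append, List.mem_cons, List.mem_append,
      List.not_mem_nil, or_false] at h
    rcases h with rfl | (h | rfl) | h
    · simp
    · have := QUBOWriter.inner_of_mem h
      cases a <;> simp_all [QUBOWriter.Inner]
    · simp
    · exact ih h

end Role

/-! ### Core and parts of the Hamiltonian -/

namespace CNFFormula

open Role
open QUBOWriter (Member)

variable (φ : CNFFormula)

theorem roles_getElem_of_lt {p : ℕ} (hp : p < φ.roles.length) (hn : φ.n < p) :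
    φ.roles[p] ≠ guard ∧ ∀ i, φ.roles[p] ≠ var i := by
  have h : φ.roles[p] ∈ pad :: ofClauses 0 φ.natClauses := by
    simp only [roles]
    rw [List.getElem_append_right (by simpa using hn)]
    exact List.getElem_mem _
  rcases List.mem_cons.1 h with h | h
  · simp [h]
  · exact not_core_of_mem_ofClauses h

theorem eq_zero_of_roles_eq_guard {p : Fin φ.roles.length} (h : φ.roles.get p = guard) :
    (p : ℕ) = 0 := by
  by_contra hp
  obtain ⟨p, hlt⟩ := p
  obtain ⟨p, rfl⟩ := Nat.exists_eq_succ_of_ne_zero hp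
  by_cases hn : φ.n < p + 1
  · exact (φ.roles_getElem_of_lt hlt hn).1 h
  · have : p < φ.n := by omega
    simp [roles, this] at h

theorem eq_of_roles_eq_var {p : Fin φ.roles.length} {i : ℕ} (h : φ.roles.get p = var i) :
    (p : ℕ) = i + 1 ∧ (p : ℕ) ≤ φ.n := by
  obtain ⟨p, hlt⟩ := p
  by_cases hn : φ.n < p
  · exact ((φ.roles_getElem_of_lt hlt hn).2 i h).elim
  · rcases p with _ | p
    · simp [roles] at h
    · have : p < φ.n := by omega
      simp [roles, this] at h
      simp only
      omega

theorem roles_get_injOn {p q : Fin φ.roles.length} {a : Role} (h : a = guard ∨ ∃ i, a = var i)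
    (hp : φ.roles.get p = a) (hq : φ.roles.get q = a) : p = q := by
  rcases h with rfl | ⟨i, rfl⟩
  · exact Fin.ext ((φ.eq_zero_of_roles_eq_guard hp).trans (φ.eq_zero_of_roles_eq_guard hq).symm)
  · exact Fin.ext ((φ.eq_of_roles_eq_var hp).1.trans (φ.eq_of_roles_eq_var hq).1.symm)

/-- The variables of the Hamiltonian that stand for the guard and the variables of the formula. -/
def core : Finset (Fin φ.roles.length) := Finset.univ.filter fun p => (p : ℕ) ≤ φ.n

theorem card_core_le : φ.core.card ≤ φ.n + 1 := by
  rw [← Finset.card_range (φ.n + 1)]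
  exact Finset.card_le_card_of_injOn (fun p => (p : ℕ))
    (fun p hp => by simpa [core, Nat.lt_succ_iff] using hp) fun _ _ _ _ h => Fin.ext h

theorem mem_core {p : Fin φ.roles.length}
    (h : φ.roles.get p = guard ∨ ∃ i, φ.roles.get p = var i) : p ∈ φ.core := by
  rcases h with h | ⟨i, h⟩
  · simp [core, φ.eq_zero_of_roles_eq_guard h]
  · simp [core, (φ.eq_of_roles_eq_var h).2]

theorem partner_core {a : Role} (h : a.partner ≠ pad) :
    a.partner = guard ∨ ∃ i, a.partner = var i := by
  cases a <;> simp_all [partner]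

/-- The part of a variable after the removal of the core: a clause, or the variable itself. -/
def part (p : Fin φ.roles.length) : ℕ ⊕ ℕ :=
  match φ.roles.get p with
  | start c => .inl c
  | lit c _ _ => .inl c
  | _ => .inr p

theorem part_eq_inl {p : Fin φ.roles.length} {c : ℕ} :
    φ.part p = .inl c ↔ Member c (φ.roles.get p) := by
  unfold part
  cases φ.roles.get p <;> simp [Member]

theorem part_eq_inr {p : Fin φ.roles.length} {r : ℕ} (h : φ.part p = .inr r) : (p : ℕ) = r := by
  unfold part at h
  cases hp : φ.roles.get p <;> simp_all

/-- A term of the Hamiltonian is the linear term of the guard, or belongs to a clause. -/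
theorem term_cases (t : φ.toQUBO.Term) :
    φ.roles.get t.1.1 = guard ∧ t.1.1 = t.1.2 ∨
      ∃ c, Member c (φ.roles.get t.1.2) ∧
        (φ.roles.get t.1.1 = (φ.roles.get t.1.2).partner ∧ (φ.roles.get t.1.2).partner ≠ pad ∨
          Member c (φ.roles.get t.1.1)) := by
  obtain ⟨⟨p, q⟩, hpq, hw⟩ := t
  rcases hpq.lt_or_eq with h | h
  · refine .inr (eq_partner_or_of_coupling_ne_zero ?_)
    rwa [φ.toQUBO_weight_of_lt h] at hw
  · obtain rfl : p = q := h
    have hw : (φ.roles.get p).diag ≠ 0 := fun h => hw ((φ.toQUBO_weight_self p).trans h)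
    change φ.roles.get p = guard ∧ p = p ∨ ∃ c, Member c (φ.roles.get p) ∧ (_ ∨
      Member c (φ.roles.get p))
    cases h : φ.roles.get p <;> simp_all [diag, Member]

/-- Terms are filed under the part of their second variable; this gives the edge condition of
`treewidth_le_of_parts` for both graphs. -/
theorem term_part (t : φ.toQUBO.Term) {v : Fin φ.roles.length} (hv : v = t.1.1 ∨ v = t.1.2) :
    v ∈ φ.core ∨ φ.part v = φ.part t.1.2 := by
  rcases hv with rfl | rfl
  · rcases φ.term_cases t with h | ⟨c, h₂, ⟨h, h'⟩ | h⟩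
    · exact .inl (φ.mem_core (.inl h.1))
    · exact .inl (φ.mem_core (h ▸ partner_core h'))
    · exact .inr ((φ.part_eq_inl.2 h).trans (φ.part_eq_inl.2 h₂).symm)
  · exact .inr rfl

variable {φ} {k : ℕ}

theorem card_members_le (hφ : φ.IsKCNF k) (c : ℕ) :
    (Finset.univ.filter fun p => φ.part p = .inl c).card ≤ k + 1 := by
  simp only [part_eq_inl, ← isMember_iff]
  rw [card_filter_get φ.roles (isMember c)]
  have h := countP_ofClauses_le c 0 k φ.natClauses fun cl hcl => by
    obtain ⟨c, hc, rfl⟩ := List.mem_map.1 hcl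
    simpa using hφ c hc
  have h' : (List.map var (List.range φ.n)).countP (isMember c) = 0 := by
    simp [List.countP_eq_zero, isMember]
  simpa [roles, List.countP_append, List.countP_cons, isMember, h'] using h

theorem card_part_le (hφ : φ.IsKCNF k) (i : ℕ ⊕ ℕ) :
    (Finset.univ.filter fun p => φ.part p = i).card ≤ k + 1 := by
  rcases i with c | r
  · exact card_members_le hφ c
  · refine (Finset.card_le_one.2 fun p hp q hq => Fin.ext ?_).trans (Nat.le_add_left 1 k)
    rw [φ.part_eq_inr (Finset.mem_filter.1 hp).2, φ.part_eq_inr (Finset.mem_filter.1 hq).2]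

/-- The core has at most `n + 1` elements, and a clause has at most `k + 1` selectors. -/
theorem tw_toQUBO_le (hφ : φ.IsKCNF k) : φ.toQUBO.tw ≤ φ.n + 1 + (k + 1) := by
  refine (treewidth_le_of_parts (V := Fin φ.roles.length) _ φ.core φ.part (k + 1) ?_ ?_).trans
    (Nat.add_le_add_right φ.card_core_le _)
  · have key (u v : Fin φ.roles.length) (t : φ.toQUBO.Term) (hu : u = t.1.1 ∨ u = t.1.2)
        (hv : v = t.1.1 ∨ v = t.1.2) : u ∈ φ.core ∨ v ∈ φ.core ∨ φ.part u = φ.part v := by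
      rcases φ.term_part t hu with h | h
      · exact .inl h
      · rcases φ.term_part t hv with h' | h'
        · exact .inr (.inl h')
        · exact .inr (.inr (h.trans h'.symm))
    intro u v h
    rcases h.2 with ⟨t, hu, hv⟩ | ⟨t, hv, hu⟩ <;> exact key u v t hu hv
  · exact fun i => (Finset.card_le_card fun p hp => by
      simp only [Finset.mem_filter] at hp ⊢
      exact ⟨hp.1, hp.2.2⟩).trans (card_part_le hφ i)

noncomputable instance (H : QUBO) : Fintype H.Term :=
  inferInstanceAs (Fintype {p : Fin H.n × Fin H.n // p.1 ≤ p.2 ∧ H.weight p.1 p.2 ≠ 0})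

theorem card_terms_le (hφ : φ.IsKCNF k) (i : ℕ ⊕ ℕ) :
    (Finset.univ.filter fun t : φ.toQUBO.Term => φ.part t.1.2 = i).card ≤ (k + 1) * (k + 2) := by
  classical
  let members : Finset (Fin φ.roles.length) := Finset.univ.filter fun p => φ.part p = i
  -- A term is determined by its second variable and, if that lies in the same part, its first one.
  -- Otherwise the first variable has the role selected by the second, and this role occurs only
  -- once.
  let f (t : φ.toQUBO.Term) : Fin φ.roles.length × Option (Fin φ.roles.length) :=
    (t.1.2, if φ.part t.1.1 = i then some t.1.1 else none)
  have hm (p : Fin φ.roles.length) : p ∈ members ↔ φ.part p = i := by simp [members]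
  have hcard : (members ×ˢ members.insertNone).card ≤ (k + 1) * (k + 2) := by
    rw [Finset.card_product, Finset.card_insertNone]
    have := card_part_le hφ i
    exact Nat.mul_le_mul this (Nat.succ_le_succ this)
  refine (Finset.card_le_card_of_injOn f (fun t ht => ?_) fun t ht t' ht' h => ?_).trans hcard
  · have ht : φ.part t.1.2 = i := by simpa using ht
    refine Finset.mem_product.2 ⟨(hm _).2 ht, Finset.mem_insertNone.2 fun a ha => (hm a).2 ?_⟩
    simp only [f] at ha
    split_ifs at ha with h
    · exact Option.mem_some_iff.1 ha ▸ h
    · simp at ha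
  · have ht : φ.part t.1.2 = i := by simpa using ht
    have ht' : φ.part t'.1.2 = i := by simpa using ht'
    obtain ⟨h₁, h₂⟩ := Prod.mk.inj h
    refine Subtype.ext (Prod.ext ?_ h₁)
    by_cases hp : φ.part t.1.1 = i
    · by_cases hp' : φ.part t'.1.1 = i
      · rw [if_pos hp, if_pos hp'] at h₂
        exact Option.some.inj h₂
      · simp [hp, hp'] at h₂
    · by_cases hp' : φ.part t'.1.1 = i
      · simp [hp, hp'] at h₂
      · have key (s : φ.toQUBO.Term) (hs : φ.part s.1.2 = i) (hn : φ.part s.1.1 ≠ i) :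
            φ.roles.get s.1.1 = (φ.roles.get s.1.2).partner ∧
              (φ.roles.get s.1.2).partner ≠ pad := by
          rcases φ.term_cases s with h | ⟨c, h₂, h | h⟩
          · exact absurd (h.2 ▸ hs) hn
          · exact h
          · exact absurd ((φ.part_eq_inl.2 h).trans ((φ.part_eq_inl.2 h₂).symm.trans hs)) hn
        have k₁ := key t ht hp
        have k₂ := key t' ht' hp'
        rw [← h₁] at k₂
        exact φ.roles_get_injOn (partner_core k₁.2) k₁.1 k₂.1

/-- The same core works, with each clause part enlarged by the terms filed under it. -/
theorem itw_toQUBO_le (hφ : φ.IsKCNF k) :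
    φ.toQUBO.itw ≤ φ.n + 1 + ((k + 1) + (k + 1) * (k + 2)) := by
  classical
  let core' : Finset (Fin φ.roles.length ⊕ φ.toQUBO.Term) := φ.core.map .inl
  let part' : Fin φ.roles.length ⊕ φ.toQUBO.Term → ℕ ⊕ ℕ :=
    Sum.elim φ.part fun t => φ.part t.1.2
  refine (treewidth_le_of_parts (V := Fin φ.roles.length ⊕ φ.toQUBO.Term) _ core' part' _
    ?_ ?_).trans (Nat.add_le_add_right ((Finset.card_map _).trans_le φ.card_core_le) _)
  · intro a b h
    rcases h.2 with ⟨v, t, rfl, rfl, hv⟩ | ⟨v, t, rfl, rfl, hv⟩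
    · rcases φ.term_part t hv with h | h
      · exact .inl (Finset.mem_map_of_mem _ h)
      · exact .inr (.inr h)
    · rcases φ.term_part t hv with h | h
      · exact .inr (.inl (Finset.mem_map_of_mem _ h))
      · exact .inr (.inr h.symm)
  · intro i
    calc _ ≤ ((Finset.univ.filter fun p => φ.part p = i).disjSum
          (Finset.univ.filter fun t : φ.toQUBO.Term => φ.part t.1.2 = i)).card :=
          Finset.card_le_card fun a ha => by
            have := (Finset.mem_filter.1 ha).2.2
            rcases a with p | t <;> simpa [part'] using this
      _ ≤ _ := by
          rw [Finset.card_disjSum]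
          exact Nat.add_le_add (card_part_le hφ i) (card_terms_le hφ i)

end CNFFormula

/-! ### Lower bounds -/

theorem RowTransducer.length_emit_le {A S : Type} (T : RowTransducer A S) (s : S) (W : List A) :
    (T.emit s W).length ≤ 5 * W.length := by
  induction W generalizing s with
  | nil => rfl
  | cons a W ih =>
    have := T.length_le s a
    have := ih (T.step s a).1
    simp only [emit, List.length_append, List.length_cons]
    omega

theorem RowTransducer.length_rows_le {A S : Type} (T : RowTransducer A S) (k : ℕ) (W : List A) :
    (T.rows k W).length ≤ k * (5 * W.length + 2) := by
  induction k generalizing W with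
  | zero => simp [rows]
  | succ k ih =>
    have := T.length_emit_le T.rowStart W
    have := ih (T.rewrite T.rowStart W)
    rw [T.length_rewrite] at this
    rw [Nat.succ_mul]
    generalize k * (5 * W.length + 2) = a at *
    simp only [rows, List.length_append, List.length_cons]
    omega

theorem eval_mono_nat (p : Polynomial ℕ) {a b : ℕ} (h : a ≤ b) : p.eval a ≤ p.eval b := by
  rw [Polynomial.eval_eq_sum_range, Polynomial.eval_eq_sum_range]
  gcongr

/-- A fast algorithm for QUBO yields a fast algorithm for `k`-SAT. -/
theorem ksatSolvableInTime_of_quboSolvableInTime {T : QUBO → ℝ} (h : QUBOSolvableInTime T) {k : ℕ}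
    {δ C : ℝ} (hδ : 0 ≤ δ)
    (hT : ∀ φ : CNFFormula, φ.IsKCNF k → T φ.toQUBO ≤ C * (2 : ℝ) ^ (δ * (φ.n : ℝ))) :
    KSATSolvableInTime k δ := by
  obtain ⟨M, p, hM⟩ := h
  -- For input length `L`, there are `L + 1` rows of at most `5 (L + 1)` symbols and two brackets.
  let q : Polynomial ℕ := (.X + 1) * (5 * (.X + 1) + 2)
  refine ⟨RowSolver.machine quboWriter M,
    .C ⌈C⌉₊ * p.comp q + (2 * (.X + 4) ^ 2 + q + .X), fun φ hφ => ?_⟩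
  obtain ⟨x, t, hx, ht, htT⟩ := hM φ.toQUBO
  obtain ⟨u, y, hxu, hu⟩ := φ.guard_of_isGroundState x hx
  set L := φ.encode.length with hL
  have hlen : φ.roles.length = L + 1 := by
    have := congrArg List.length (QUBOWriter.word_encode φ)
    simpa [RowTransducer.word, quboWriter.length_readWord, eq_comm] using this
  have hy : y.length = L := by
    have := congrArg List.length hxu
    rw [List.length_cons] at this
    exact Nat.succ_injective (this.symm.trans (List.length_ofFn.trans hlen))
  have hH : φ.toQUBO.encode.length ≤ q.eval L := by
    rw [← QUBOWriter.encode_toQUBO]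
    refine (quboWriter.length_rows_le _ _).trans (le_of_eq ?_)
    simp [q, RowTransducer.word, quboWriter.length_readWord, hL]
  have hxu' : List.ofFn x = u :: y := hxu
  rw [hxu', ← QUBOWriter.encode_toQUBO] at ht
  refine ⟨!u, _, hu, RowSolver.outputsInTime quboWriter M φ.encode u y t ht, ?_⟩
  rw [QUBOWriter.encode_toQUBO, hy, ← hL]
  -- Nonnegativity of `δ` lets the exponential factor absorb the polynomial overhead.
  have h1 : (1 : ℝ) ≤ 2 ^ (δ * (φ.n : ℝ)) := Real.one_le_rpow (by norm_num) (by positivity)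
  have ht' : (t : ℝ) ≤ 2 ^ (δ * (φ.n : ℝ)) * ((⌈C⌉₊ * p.eval (q.eval L) : ℕ) : ℝ) :=
    calc (t : ℝ) ≤ T φ.toQUBO * (p.eval φ.toQUBO.encode.length : ℕ) := htT
      _ ≤ (C * 2 ^ (δ * (φ.n : ℝ))) * (p.eval φ.toQUBO.encode.length : ℕ) := by
        gcongr
        exact hT φ hφ
      _ ≤ (⌈C⌉₊ * 2 ^ (δ * (φ.n : ℝ))) * (p.eval (q.eval L) : ℕ) := by
        gcongr
        · exact Nat.le_ceil C
        · exact eval_mono_nat p hH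
      _ = _ := by push_cast; ring
  have hrest : ((2 * (L + 4) ^ 2 + φ.toQUBO.encode.length + L : ℕ) : ℝ) ≤
      2 ^ (δ * (φ.n : ℝ)) * ((2 * (L + 4) ^ 2 + q.eval L + L : ℕ) : ℝ) := by
    refine le_trans ?_ (le_mul_of_one_le_left (Nat.cast_nonneg _) h1)
    exact_mod_cast Nat.add_le_add_right (Nat.add_le_add_left hH _) _
  have heval : (.C ⌈C⌉₊ * p.comp q + (2 * (.X + 4) ^ 2 + q + .X) : Polynomial ℕ).eval L =
      ⌈C⌉₊ * p.eval (q.eval L) + (2 * (L + 4) ^ 2 + q.eval L + L) := by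
    simp [Polynomial.eval_comp]
  rw [heval, Nat.cast_add t, Nat.cast_add (_ * _), mul_add]
  exact add_le_add ht' hrest

/-- If `w` is bounded by the number of variables of the formula up to a constant, then an algorithm
for QUBO in time `2 ^ (δ w)` yields an algorithm for `k`-SAT. -/
theorem ksatSolvableInTime_of_le {T : QUBO → ℝ} (h : QUBOSolvableInTime T) (w : QUBO → ℕ) {k : ℕ}
    {δ C : ℝ} (hδ : 0 ≤ δ) (hC : 0 ≤ C) (hT : ∀ H, T H ≤ C * (2 : ℝ) ^ (δ * (w H : ℝ))) (c : ℕ)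
    (hw : ∀ φ : CNFFormula, φ.IsKCNF k → w φ.toQUBO ≤ φ.n + c) :
    KSATSolvableInTime k δ := by
  refine ksatSolvableInTime_of_quboSolvableInTime (C := C * 2 ^ (δ * c)) h hδ fun φ hφ => ?_
  have hw' : (w φ.toQUBO : ℝ) ≤ c + φ.n := by
    rw [add_comm]; exact_mod_cast hw φ hφ
  calc T φ.toQUBO ≤ C * 2 ^ (δ * (w φ.toQUBO : ℝ)) := hT _
    _ ≤ C * 2 ^ (δ * (c + φ.n : ℝ)) := by
      gcongr
      norm_num
    _ = _ := by rw [mul_add, Real.rpow_add (by norm_num), mul_assoc]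

theorem ksatSolvableInTime_of_tw {T : QUBO → ℝ} (h : QUBOSolvableInTime T) {δ C : ℝ} (hδ : 0 ≤ δ)
    (hC : 0 ≤ C) (hT : ∀ H, T H ≤ C * (2 : ℝ) ^ (δ * (H.tw : ℝ))) (k : ℕ) :
    KSATSolvableInTime k δ :=
  ksatSolvableInTime_of_le h QUBO.tw hδ hC hT (1 + (k + 1)) fun φ hφ => by
    have := φ.tw_toQUBO_le hφ; omega

theorem ksatSolvableInTime_of_itw {T : QUBO → ℝ} (h : QUBOSolvableInTime T) {δ C : ℝ} (hδ : 0 ≤ δ)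
    (hC : 0 ≤ C) (hT : ∀ H, T H ≤ C * (2 : ℝ) ^ (δ * (H.itw : ℝ))) (k : ℕ) :
    KSATSolvableInTime k δ :=
  ksatSolvableInTime_of_le h QUBO.itw hδ hC hT (1 + ((k + 1) + (k + 1) * (k + 2))) fun φ hφ => by
    have := φ.itw_toQUBO_le hφ; omega

/-- A sublinear function is bounded by a linear function of arbitrarily small slope. -/
theorem exists_le_of_isLittleO {g : ℕ → ℝ} (hg : g =o[atTop] fun k : ℕ => (k : ℝ)) {δ : ℝ}
    (hδ : 0 < δ) : ∃ B : ℝ, ∀ k, g k ≤ B + δ * k := by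
  obtain ⟨N, hN⟩ := eventually_atTop.1 (hg.bound hδ)
  obtain ⟨B, hB⟩ := ((Finset.range N).image g).bddAbove
  -- `B` covers the finitely many `k < N`; beyond `N` the slope alone suffices, provided the
  -- constant is nonnegative.
  refine ⟨max B 0, fun k => ?_⟩
  rcases lt_or_ge k N with h | h
  · have : g k ≤ B := hB (by simpa using ⟨k, h, rfl⟩)
    have := le_max_left B 0
    have : 0 ≤ δ * k := by positivity
    linarith
  · have h' := hN k h
    rw [Real.norm_natCast] at h'
    have := (le_abs_self (g k)).trans h'
    have := le_max_right B 0
    linarith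

theorem rpow_le_of_le {B δ : ℝ} {g : ℕ → ℝ} (h : ∀ k, g k ≤ B + δ * k) (k : ℕ) :
    (2 : ℝ) ^ g k ≤ 2 ^ B * 2 ^ (δ * (k : ℝ)) := by
  rw [← Real.rpow_add (by norm_num)]
  exact Real.rpow_le_rpow_of_exponent_le (by norm_num) (h k)

theorem mainTheorem5 :
    (SETH →
      (∀ ε : ℝ, 0 < ε →
        ¬ QUBOSolvableInTime fun H => (2 : ℝ) ^ ((1 - ε) * (H.tw : ℝ))) ∧
      (∀ f : ℕ → ℝ, f =o[atTop] (fun k : ℕ => (2 : ℝ) ^ ((k : ℝ) / 3)) →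
        ¬ QUBOSolvableInTime fun H => f H.itw)) ∧
    (ETH →
      (∀ g : ℕ → ℝ, g =o[atTop] (fun k : ℕ => (k : ℝ)) →
        ¬ QUBOSolvableInTime fun H => (2 : ℝ) ^ (g H.tw)) ∧
      (∀ g : ℕ → ℝ, g =o[atTop] (fun k : ℕ => (k : ℝ)) →
        ¬ QUBOSolvableInTime fun H => (2 : ℝ) ^ (g H.itw))) := by
  refine ⟨fun hS => ⟨fun ε hε h => ?_, fun f hf h => ?_⟩, fun ⟨δ, hδ, hE⟩ =>
    ⟨fun g hg h => ?_, fun g hg h => ?_⟩⟩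
  -- The reduction needs a nonnegative exponent, hence the maximum, which matters for `ε > 1`.
  · obtain ⟨k, hk⟩ := hS (max (1 - ε) 0) (max_lt (by linarith) one_pos)
    refine hk (ksatSolvableInTime_of_tw (C := 1) h (le_max_right _ _) zero_le_one (fun H => ?_) k)
    rw [one_mul]
    gcongr
    · norm_num
    · exact le_max_left _ _
  -- The exponent `1 / 3` is not sharp here: since the incidence treewidth is at most `n` plus a
  -- constant, any exponent in `[0, 1)` could replace it. Only `O` is used, not `o`.
  · obtain ⟨k, hk⟩ := hS (1 / 3) (by norm_num)
    obtain ⟨C, hC, hf⟩ := bound_of_isBigO_nat_atTop hf.isBigO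
    refine hk (ksatSolvableInTime_of_itw h (by norm_num) hC.le (fun H => ?_) k)
    have hpos : (0 : ℝ) < 2 ^ ((H.itw : ℝ) / 3) := by positivity
    have := (le_abs_self _).trans (hf (x := H.itw) hpos.ne')
    rwa [Real.norm_of_nonneg hpos.le, div_eq_inv_mul, ← one_div] at this
  -- The slope is the very `δ` for which ETH excludes 3-SAT algorithms.
  · obtain ⟨B, hB⟩ := exists_le_of_isLittleO hg hδ
    exact hE (ksatSolvableInTime_of_tw h hδ.le (by positivity) (fun H => rpow_le_of_le hB _) 3)
  · obtain ⟨B, hB⟩ := exists_le_of_isLittleO hg hδ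
    exact hE (ksatSolvableInTime_of_itw h hδ.le (by positivity) (fun H => rpow_le_of_le hB _) 3)
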